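/- Let $k\ge 1$ be an integer. Let $d\lambda(z)=\pi^{-k}e^{-|z|^2}\,dz$ be the Gaussian measure on $\mathbb{C}^k$, let $\mathcal F(\mathbb{C}^k)$ be the Fock space of all holomorphic functions on $\mathbb{C}^k$ that are square integrable with respect to $\lambda$, and let $K_z(w)=e^{w_1\bar z_1+\cdots+w_k\bar z_k}$. For a measurable, essentially bounded function $\varphi:\mathbb{C}^k\to\mathbb{C}$, the Toeplitz operator $T_\varphi$ on $\mathcal F(\mathbb{C}^k)$ is $$T_\varphi f(z)=\int_{\mathbb{C}^k}\varphi(w)f(w)\overline{K_z(w)}\,d\lambda(w).$$ The symbol $\varphi$ is called separately radial if $\varphi(t_1z_1,\dots,t_kz_k)=\varphi(z_1,\dots,z_k)$ for all $z\in\mathbb{C}^k$ and all $t_1,\dots,t_k\in\mathbb{C}$ with $|t_i|=1$. For such $\varphi$ and $\mathbf m=(m_1,\dots,m_k)\in\mathbb{N}_0^k$, the operator $T_\varphi$ acts on the span of the monomial $z_1^{m_1}\cdots z_k^{m_k}$ as multiplication by a scalar $\gamma(\mathbf m)\in\mathbb{C}$; the function $\gamma:\mathbb{N}_0^k\to\mathbb{C}$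 is the eigenvalue function of $T_\varphi$. Let $\mathfrak G_{\mathbf 1}$ be the set of the eigenvalue functions of all Toeplitz operators $T_\varphi$ with separately radial symbols $\varphi$. Let $\rho_k(\mathbf m,\mathbf m')=\sum_{i=1}^k\bigl|\sqrt{m_i}-\sqrt{m_i'}\bigr|$ be the square-root metric on $\mathbb{N}_0^k$, and let $C_{b,u}(\mathbb{N}_0^k,\rho_k)$ be the space of all bounded functions $\mathbb{N}_0^k\to\mathbb{C}$ that are uniformly continuous with respect to $\rho_k$, with the supremum norm. Theorem. $\mathfrak G_{\mathbf 1}$ is a dense subset of $C_{b,u}(\mathbb{N}_0^k,\rho_k)$ in the supremum norm; that is, $\mathfrak G_{\mathbf 1}\subseteq C_{b,u}(\mathbb{N}_0^k,\rho_k)$, and for every $\sigma\in C_{b,u}(\mathbb{N}_0^k,\rho_k)$ and every $\varepsilon>0$ there is $\gamma\in\mathfrak G_{\mathbf 1}$ with $\|\sigma-\gamma\|_\infty<\varepsilon$. -/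

import Mathlib

open MeasureTheory BoundedContinuousFunction
open scoped ComplexConjugate

noncomputable section

namespace FockToeplitz

/-! ### The Gaussian measure and the Fock space -/

/-- The Gaussian measure `dλ(z) = π⁻ᵏ exp (-|z|²) dz` on `ℂᵏ`, with `|z|² = ∑ᵢ |zᵢ|²` and
`dz` the Lebesgue measure on `ℂᵏ ≃ ℝ²ᵏ`. -/
def gaussianMeasure (k : ℕ) : Measure (Fin k → ℂ) :=
  volume.withDensity fun z =>
    ENNReal.ofReal ((Real.pi ^ k)⁻¹ * Real.exp (-∑ i, ‖z i‖ ^ 2))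

/-- The Fock space `F(ℂᵏ)`: the holomorphic (entire) functions on `ℂᵏ` that are square integrable
with respect to the Gaussian measure. -/
def fockSpace (k : ℕ) : Submodule ℂ ((Fin k → ℂ) → ℂ) where
  carrier := {f | Differentiable ℂ f ∧ MemLp f 2 (gaussianMeasure k)}
  add_mem' hf hg := ⟨hf.1.add hg.1, hf.2.add hg.2⟩
  zero_mem' := ⟨differentiable_const 0, MemLp.zero⟩
  smul_mem' c _ hf := ⟨hf.1.const_smul c, hf.2.const_smul c⟩

/-- The reproducing kernel `K_z(w) = exp (w₁ z̄₁ + ⋯ + w_k z̄_k)` of the Fock space. -/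
def kernel {k : ℕ} (z w : Fin k → ℂ) : ℂ :=
  Complex.exp (∑ i, w i * conj (z i))

/-- The Bergman projection `(P g)(z) = ⟨g, K_z⟩ = ∫ g(w) conj (K_z(w)) dλ(w)`. -/
def bergmanProjection {k : ℕ} (g : (Fin k → ℂ) → ℂ) : (Fin k → ℂ) → ℂ :=
  fun z => ∫ w, g w * conj (kernel z w) ∂gaussianMeasure k

/-- The Toeplitz operator with symbol `φ` on the Fock space,
`(T_φ f)(z) = P(φ f)(z) = ∫ φ(w) f(w) conj (K_z(w)) dλ(w)`. -/
def toeplitz {k : ℕ} (φ : (Fin k → ℂ) → ℂ) (f : fockSpace k) : (Fin k → ℂ) → ℂ :=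
  bergmanProjection fun w => φ w * (f : (Fin k → ℂ) → ℂ) w

/-! ### The spaces of multihomogeneous polynomials -/

theorem integrable_pow_mul_exp (n : ℕ) :
    Integrable (fun z : ℂ => ‖z‖ ^ (2 * n) * Real.exp (-‖z‖ ^ 2)) := by
  have h := (GaussianFourier.integrable_cexp_neg_mul_sq_norm_add (V := ℂ) (b := 1 / 2)
    (by norm_num) 0 0).norm
  refine (h.const_mul (2 ^ n * (n.factorial : ℝ))).mono' (by fun_prop) ?_
  filter_upwards with z
  have e : ‖Complex.exp (-(1 / 2) * (‖z‖ : ℂ) ^ 2 + 0 * ((inner ℝ 0 z : ℝ) : ℂ))‖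
      = Real.exp (-(‖z‖ ^ 2 / 2)) := by
    rw [Complex.norm_exp]
    congr 1
    have : (-(1 / 2) * (‖z‖ : ℂ) ^ 2 + 0 * ((inner ℝ 0 z : ℝ) : ℂ))
        = ((-(‖z‖ ^ 2 / 2) : ℝ) : ℂ) := by
      push_cast; ring
    rw [this, Complex.ofReal_re]
  rw [e, Real.norm_of_nonneg (by positivity)]
  have hp := Real.pow_div_factorial_le_exp (‖z‖ ^ 2 / 2) (by positivity) n
  rw [div_le_iff₀ (by positivity)] at hp
  have hs : Real.exp (-‖z‖ ^ 2) = Real.exp (-(‖z‖ ^ 2 / 2)) * Real.exp (-(‖z‖ ^ 2 / 2)) := by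
    rw [← Real.exp_add]; congr 1; ring
  have hq : Real.exp (‖z‖ ^ 2 / 2) * Real.exp (-(‖z‖ ^ 2 / 2)) = 1 := by
    rw [← Real.exp_add]; simp
  calc ‖z‖ ^ (2 * n) * Real.exp (-‖z‖ ^ 2)
      = 2 ^ n * (‖z‖ ^ 2 / 2) ^ n *
          (Real.exp (-(‖z‖ ^ 2 / 2)) * Real.exp (-(‖z‖ ^ 2 / 2))) := by
        rw [hs, pow_mul, ← mul_pow]; congr 2; ring
    _ ≤ 2 ^ n * (Real.exp (‖z‖ ^ 2 / 2) * (n.factorial : ℝ)) *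
          (Real.exp (-(‖z‖ ^ 2 / 2)) * Real.exp (-(‖z‖ ^ 2 / 2))) := by gcongr
    _ = 2 ^ n * (n.factorial : ℝ) * Real.exp (-(‖z‖ ^ 2 / 2)) *
          (Real.exp (‖z‖ ^ 2 / 2) * Real.exp (-(‖z‖ ^ 2 / 2))) := by ring
    _ = 2 ^ n * (n.factorial : ℝ) * Real.exp (-(‖z‖ ^ 2 / 2)) := by rw [hq, mul_one]

theorem monomial_mem_fockSpace {k : ℕ} (m : Fin k → ℕ) :
    (fun z : Fin k → ℂ => ∏ i, z i ^ m i) ∈ fockSpace k := by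
  have hd : Differentiable ℂ (fun z : Fin k → ℂ => ∏ i, z i ^ m i) := by fun_prop
  refine ⟨hd, ?_⟩
  rw [memLp_two_iff_integrable_sq_norm hd.continuous.aestronglyMeasurable, gaussianMeasure,
    integrable_withDensity_iff (by fun_prop) (by simp)]
  have h := (Integrable.fintype_prod (f := fun (i : Fin k) (z : ℂ) =>
    ‖z‖ ^ (2 * m i) * Real.exp (-‖z‖ ^ 2)) (μ := fun _ => volume)
    fun i => integrable_pow_mul_exp (m i)).const_mul (Real.pi ^ k)⁻¹
  refine h.congr ?_
  filter_upwards with z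
  rw [ENNReal.toReal_ofReal (by positivity), norm_prod, ← Finset.prod_pow, Finset.prod_mul_distrib,
    ← Finset.sum_neg_distrib, Real.exp_sum]
  simp only [norm_pow, ← pow_mul, mul_comm 2]
  ring

/-- The monomial `z ↦ z₁^{m₁} ⋯ z_k^{m_k}` as an element of the Fock space. -/
def fockMonomial {k : ℕ} (m : Fin k → ℕ) : fockSpace k :=
  ⟨fun z => ∏ i, z i ^ m i, monomial_mem_fockSpace m⟩

/-- The space `P_{m₁}(ℂ) ⊗ ⋯ ⊗ P_{m_k}(ℂ) ⊆ F(ℂᵏ)`, where `P_d(ℂ) = ℂ zᵈ` is the space of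
homogeneous holomorphic polynomials of degree `d` in one complex variable: the polynomials on `ℂᵏ`
that are homogeneous of degree `mᵢ` in the `i`-th variable for every `i`. -/
def multihomogeneous {k : ℕ} (m : Fin k → ℕ) : Submodule ℂ (fockSpace k) :=
  Submodule.span ℂ {fockMonomial m}

/-! ### Separately radial symbols and eigenvalue functions -/

/-- Separately radial symbols: essentially bounded measurable functions on `ℂᵏ` that are
invariant under `U(1) × ⋯ × U(1)` acting coordinatewise. -/
structure IsSeparatelyRadialSymbol {k : ℕ} (φ : (Fin k → ℂ) → ℂ) : Prop where
  measurable : Measurable φ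
  essBounded : MemLp φ ⊤ volume
  invariant : ∀ (t : Fin k → Circle) (z : Fin k → ℂ), φ (fun i => (t i : ℂ) * z i) = φ z

/-- `γ` is the eigenvalue function of `T_φ`: for every `m`, the operator `T_φ` acts on
`P_{m₁}(ℂ) ⊗ ⋯ ⊗ P_{m_k}(ℂ)` as the scalar `γ m`. -/
def IsEigenvalueFunction {k : ℕ} (φ : (Fin k → ℂ) → ℂ) (γ : (Fin k → ℕ) → ℂ) : Prop :=
  ∀ m : Fin k → ℕ, ∀ f ∈ multihomogeneous m, toeplitz φ f = γ m • (f : (Fin k → ℂ) → ℂ)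

/-- The set `𝔊₁` of all eigenvalue functions of Toeplitz operators on `F(ℂᵏ)` with separately
radial symbols. -/
def eigenvalueFunctions (k : ℕ) : Set ((Fin k → ℕ) → ℂ) :=
  {γ | ∃ φ : (Fin k → ℂ) → ℂ, IsSeparatelyRadialSymbol φ ∧ IsEigenvalueFunction φ γ}

/-! ### Bounded functions that are uniformly continuous for the square-root metric -/

/-- The square-root metric `ρ(m, m') = ∑ᵢ |√mᵢ - √m'ᵢ|` on `ℕ₀ᵏ`. -/
def sqrtDist {k : ℕ} (m m' : Fin k → ℕ) : ℝ :=
  ∑ i, |√(m i : ℝ) - √(m' i : ℝ)|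

/-- The space `C_{b,u}(ℕ₀ᵏ, ρ)` of bounded functions on `ℕ₀ᵏ` that are uniformly continuous with
respect to the square-root metric. As `Fin k → ℕ` carries the discrete topology,
`(Fin k → ℕ) →ᵇ ℂ` is the space of all bounded functions, with the metric of the supremum norm. -/
def Cbu (k : ℕ) : Set ((Fin k → ℕ) →ᵇ ℂ) :=
  {σ | ∀ ε > 0, ∃ δ > 0, ∀ m m' : Fin k → ℕ, sqrtDist m m' < δ → ‖σ m - σ m'‖ < ε}

end FockToeplitz

end

noncomputable section

namespace FockToeplitz

/-! Everything rests on an explicit formula: the eigenvalue `γ m` is the average of the symbol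
against the product of the probability measures with densities `|w|^(2 mᵢ) exp (-|w|²) / (π mᵢ!)`
(`toeplitz_fockMonomial`, `isEigenvalueFunction_iff`). Every bounded measurable function of the
moduli `|wᵢ|` is an admissible symbol.

Inclusion: raising `mᵢ` by one multiplies the measure by `|wᵢ|² / (mᵢ + 1)`, whose mean distance
from `1` is at most `2 (√(mᵢ + 1) - √mᵢ)`. Summing such steps makes every eigenvalue function
Lipschitz for the square-root metric.

Density in one variable: under `radialMeasure m` the law of `|w| - √m` tends in total variation to a
Gaussian of variance `1/4` (`tendsto_integral_abs_modulusDensity_sub`). For large `m` the eigenvalue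
of a symbol `b(|w|)` is thus nearly the Gaussian smoothing of `b` at `√m`. A given `σ` is read as
the step function `y ↦ σ ⌊y²⌋`. The Fourier transform of the Gaussian has no zeros, so some
integrable `h` is smoothed by the Gaussian into an approximate identity
(`exists_gaussian_deconvolution`), and `b` is the convolution of `h` with the step function. The
finitely many remaining entries are corrected by symbols whose eigenvalue sequences are uniformly
close to coordinate sequences (`exists_approx_single`).

Several variables: induction on `k` with tensor products. For this, `b` is obtained from `σ`
linearly, through a kernel whose rows have absolute sums at most `C` and which depends only on a
bound and a modulus of continuity of `σ`. One kernel then serves all slices of `σ` at once, and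
passing through it multiplies a uniform error by at most `C` (`exists_pi_kernel`). -/

/-! ### Radial measures on the plane and their moments -/

/-- The probability measure on `ℂ` with density `|w|²ᵐ exp (-|w|²) / (π m!)`. -/
def radialMeasure (m : ℕ) : Measure ℂ :=
  volume.withDensity fun w =>
    ENNReal.ofReal ((Real.pi * m.factorial)⁻¹ * (‖w‖ ^ (2 * m) * Real.exp (-‖w‖ ^ 2)))

theorem integral_norm_pow_mul_exp (n : ℕ) :
    ∫ w : ℂ, ‖w‖ ^ (2 * n) * Real.exp (-‖w‖ ^ 2) = Real.pi * n.factorial := by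
  have h := Complex.integral_rpow_mul_exp_neg_rpow (p := 2) (q := (2 * n : ℕ)) (by norm_num)
    (by linarith [(2 * n : ℕ).cast_nonneg (α := ℝ)])
  have e : ((2 * n : ℕ) + 2 : ℝ) / 2 = n + 1 := by push_cast; ring
  rw [e, Real.Gamma_nat_eq_factorial] at h
  rw [show (2 * Real.pi / 2) = Real.pi by ring] at h
  rw [← h]
  congr 1; ext w
  rw [Real.rpow_natCast, ← Real.rpow_natCast _ 2]
  norm_num

theorem integral_radialMeasure {E : Type*} [NormedAddCommGroup E] [NormedSpace ℝ E]
    (m : ℕ) (f : ℂ → E) :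
    ∫ w, f w ∂radialMeasure m =
      ∫ w, ((Real.pi * m.factorial)⁻¹ * (‖w‖ ^ (2 * m) * Real.exp (-‖w‖ ^ 2))) • f w := by
  rw [radialMeasure, integral_withDensity_eq_integral_toReal_smul (by fun_prop) (by simp)]
  congr 1; ext w
  rw [ENNReal.toReal_ofReal (by positivity)]

theorem integrable_radialMeasure_iff {m : ℕ} {f : ℂ → ℝ} :
    Integrable f (radialMeasure m) ↔
      Integrable fun w => f w *
        ((Real.pi * m.factorial)⁻¹ * (‖w‖ ^ (2 * m) * Real.exp (-‖w‖ ^ 2))) := by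
  rw [radialMeasure, integrable_withDensity_iff (by fun_prop) (by simp)]
  refine integrable_congr (.of_forall fun w => ?_)
  simp only
  rw [ENNReal.toReal_ofReal (by positivity)]

theorem integral_norm_pow_radialMeasure (m n : ℕ) :
    ∫ w, ‖w‖ ^ (2 * n) ∂radialMeasure m = (m + n).factorial / m.factorial := by
  rw [integral_radialMeasure]
  have : ∀ w : ℂ, ((Real.pi * m.factorial)⁻¹ * (‖w‖ ^ (2 * m) * Real.exp (-‖w‖ ^ 2))) •
      ‖w‖ ^ (2 * n) = (Real.pi * m.factorial)⁻¹ *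
        (‖w‖ ^ (2 * (m + n)) * Real.exp (-‖w‖ ^ 2)) := by
    intro w; rw [smul_eq_mul, mul_add, pow_add]; ring
  simp_rw [this]
  rw [integral_const_mul, integral_norm_pow_mul_exp]
  field_simp

theorem integrable_norm_pow_radialMeasure (m n : ℕ) :
    Integrable (fun w => ‖w‖ ^ (2 * n)) (radialMeasure m) := by
  rw [integrable_radialMeasure_iff]
  refine ((integrable_pow_mul_exp (m + n)).const_mul (Real.pi * m.factorial)⁻¹).congr
    (.of_forall fun w => ?_)
  simp only
  rw [mul_add, pow_add]; ring

instance (m : ℕ) : IsProbabilityMeasure (radialMeasure m) := by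
  refine ⟨?_⟩
  rw [radialMeasure, withDensity_apply _ MeasurableSet.univ, Measure.restrict_univ,
    ← ofReal_integral_eq_lintegral_ofReal, integral_const_mul, integral_norm_pow_mul_exp]
  · rw [inv_mul_cancel₀ (by positivity), ENNReal.ofReal_one]
  · exact (integrable_pow_mul_exp m).const_mul _
  · exact .of_forall fun w => by positivity

/-! ### Products of measures with densities -/

theorem pi_withDensity_ofReal {ι : Type*} [Fintype ι] {X : ι → Type*}
    [∀ i, MeasurableSpace (X i)] (μ : ∀ i, Measure (X i)) [∀ i, SigmaFinite (μ i)]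
    {f : ∀ i, X i → ℝ} (hf : ∀ i, Integrable (f i) (μ i)) (h0 : ∀ i x, 0 ≤ f i x) :
    Measure.pi (fun i => (μ i).withDensity fun x => ENNReal.ofReal (f i x)) =
      (Measure.pi μ).withDensity fun x => ENNReal.ofReal (∏ i, f i (x i)) := by
  have : ∀ i, IsFiniteMeasure ((μ i).withDensity fun x => ENNReal.ofReal (f i x)) := fun i =>
    isFiniteMeasure_withDensity_ofReal (hf i).2
  refine (Measure.pi_eq (μ := fun i => (μ i).withDensity fun x => ENNReal.ofReal (f i x))
    fun s hs => ?_)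
  have hs' : MeasurableSet (Set.univ.pi s) := MeasurableSet.univ_pi hs
  rw [withDensity_apply _ hs', Measure.restrict_pi_pi,
    ← ofReal_integral_eq_lintegral_ofReal,
    integral_fintype_prod_eq_prod (μ := fun i => (μ i).restrict (s i)),
    ENNReal.ofReal_prod_of_nonneg]
  · refine Finset.prod_congr rfl fun i _ => ?_
    rw [withDensity_apply _ (hs i), ofReal_integral_eq_lintegral_ofReal (hf i).integrableOn]
    exact .of_forall (h0 i)
  · exact fun i _ => integral_nonneg (h0 i)
  · exact Integrable.fintype_prod_dep (f := f) (μ := fun i => (μ i).restrict (s i))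
      fun i => (hf i).integrableOn
  · exact .of_forall fun x => Finset.prod_nonneg fun i _ => h0 i _

theorem gaussianMeasure_eq_pi (k : ℕ) :
    gaussianMeasure k = Measure.pi fun _ : Fin k => radialMeasure 0 := by
  simp only [radialMeasure]
  rw [pi_withDensity_ofReal (fun _ : Fin k => (volume : Measure ℂ))
    (fun _ => (integrable_pow_mul_exp 0).const_mul _) (fun _ _ => by positivity), gaussianMeasure]
  congr 1
  ext w
  congr 1
  simp [Finset.prod_mul_distrib, ← Real.exp_sum]

theorem radialMeasure_eq_withDensity (m : ℕ) :
    radialMeasure m = (radialMeasure 0).withDensity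
      fun w => ENNReal.ofReal (‖w‖ ^ (2 * m) / m.factorial) := by
  rw [radialMeasure, radialMeasure, ← withDensity_mul _ (by fun_prop) (by fun_prop)]
  congr 1
  ext w
  simp only [Pi.mul_apply]
  rw [← ENNReal.ofReal_mul (by positivity)]
  congr 1
  simp
  field_simp

theorem pi_radialMeasure_eq_withDensity {k : ℕ} (m : Fin k → ℕ) :
    Measure.pi (fun i => radialMeasure (m i)) = (gaussianMeasure k).withDensity
      fun w => ENNReal.ofReal (∏ i, ‖w i‖ ^ (2 * m i) / (m i).factorial) := by
  rw [gaussianMeasure_eq_pi, ← pi_withDensity_ofReal (fun _ : Fin k => radialMeasure 0)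
    (f := fun i w => ‖w‖ ^ (2 * m i) / (m i).factorial)]
  · simp_rw [← radialMeasure_eq_withDensity]
  · exact fun i => (integrable_norm_pow_radialMeasure 0 (m i)).div_const _
  · exact fun i w => by positivity

theorem integral_pi_radialMeasure {k : ℕ} (m : Fin k → ℕ) (f : (Fin k → ℂ) → ℂ) :
    ∫ w, f w ∂Measure.pi (fun i => radialMeasure (m i)) =
      ∫ w, ((∏ i, ‖w i‖ ^ (2 * m i) / (m i).factorial : ℝ) : ℂ) * f w ∂gaussianMeasure k := by
  rw [pi_radialMeasure_eq_withDensity, integral_withDensity_eq_integral_toReal_smul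
    (by fun_prop) (by simp)]
  congr 1; ext w
  rw [ENNReal.toReal_ofReal (by positivity), Complex.real_smul]

theorem pi_radialMeasure_absolutelyContinuous {k : ℕ} (m : Fin k → ℕ) :
    Measure.pi (fun i => radialMeasure (m i)) ≪ volume := by
  rw [pi_radialMeasure_eq_withDensity]
  exact (withDensity_absolutelyContinuous _ _).trans (withDensity_absolutelyContinuous _ _)

/-! ### Averaging over the torus and the eigenvalue formula -/

theorem measurePreserving_rotation (t : Circle) (m : ℕ) :
    MeasurePreserving (fun w : ℂ => (t : ℂ) * w) (radialMeasure m) (radialMeasure m) := by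
  have h : MeasurePreserving (fun w : ℂ => (t : ℂ) * w) :=
    (rotation t).measurePreserving
  refine ⟨by fun_prop, ?_⟩
  ext s hs
  rw [Measure.map_apply (by fun_prop) hs, radialMeasure, withDensity_apply _ hs,
    withDensity_apply _ (h.measurable hs), ← h.setLIntegral_comp_preimage hs (by fun_prop)]
  simp only [norm_mul, Circle.norm_coe, one_mul]

/-- Integration over the torus with respect to its normalized Haar measure, in angles. -/
def angleMeasure : Measure ℝ :=
  ENNReal.ofReal (2 * Real.pi)⁻¹ • volume.restrict (Set.Ioc 0 (2 * Real.pi))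

instance : IsProbabilityMeasure angleMeasure := by
  refine ⟨?_⟩
  simp only [angleMeasure, Measure.smul_apply, Measure.restrict_apply_univ, Real.volume_Ioc,
    smul_eq_mul, sub_zero]
  rw [← ENNReal.ofReal_mul (by positivity), inv_mul_cancel₀ (by positivity), ENNReal.ofReal_one]

/-- This is Cauchy's formula on the unit circle for the `m`-th Taylor coefficient of `ζ ↦ exp (u
ζ)`, with `ζ = exp (iθ)`. -/
theorem integral_angleMeasure_exp (m : ℕ) (u : ℂ) :
    ∫ θ, ((Circle.exp (-θ) : ℂ)) ^ m * Complex.exp (conj (Circle.exp (-θ) : ℂ) * u)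
      ∂angleMeasure = u ^ m / m.factorial := by
  have hd : DiffContOnCl ℂ (fun ζ : ℂ => Complex.exp (u * ζ)) (Metric.ball 0 1) :=
    Differentiable.diffContOnCl (by fun_prop)
  have h := hd.circleIntegral_one_div_sub_center_pow_smul one_pos m
  have e : iteratedDeriv m (fun ζ : ℂ => Complex.exp (u * ζ)) 0 = u ^ m := by
    rw [iteratedDeriv_cexp_const_mul]; simp
  rw [e, circleIntegral] at h
  rw [angleMeasure, integral_smul_measure, ← intervalIntegral.integral_of_le (by positivity)]
  -- The differential `dζ = i ζ dθ` cancels one of the `m + 1` powers of `ζ` in the denominator.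
  have e2 : ∀ θ : ℝ, deriv (circleMap 0 1) θ • (fun z : ℂ => (1 / (z - 0) ^ (m + 1)) •
      (fun ζ : ℂ => Complex.exp (u * ζ)) z) (circleMap 0 1 θ) =
      Complex.I * (((Circle.exp (-θ) : ℂ)) ^ m *
        Complex.exp (conj (Circle.exp (-θ) : ℂ) * u)) := by
    intro θ
    have h1 : (circleMap 0 1 θ) = (Circle.exp θ : ℂ) := by simp [circleMap]
    have h2 : conj (Circle.exp (-θ) : ℂ) = (Circle.exp θ : ℂ) := by
      rw [Circle.exp_neg, ← Circle.coe_inv_eq_conj, inv_inv]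
    have h3 : (Circle.exp (-θ) : ℂ) = (Circle.exp θ : ℂ)⁻¹ := by
      rw [Circle.exp_neg, Circle.coe_inv]
    have h4 : (Circle.exp θ : ℂ) ≠ 0 := Circle.coe_ne_zero _
    rw [deriv_circleMap, h1, h2, h3]
    simp only [smul_eq_mul, sub_zero]
    rw [mul_comm u]
    rw [inv_pow, pow_succ]
    field_simp
  simp_rw [e2] at h
  rw [intervalIntegral.integral_const_mul] at h
  have h5 := mul_left_cancel₀ Complex.I_ne_zero (h.trans (by
    rw [smul_eq_mul]
    show _ = Complex.I * (2 * Real.pi * (u ^ m / m.factorial)); ring))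
  rw [h5, ENNReal.toReal_ofReal (by positivity), Complex.real_smul]
  have : (Real.pi : ℂ) ≠ 0 := by exact_mod_cast Real.pi_ne_zero
  push_cast
  field_simp

/-- Supplies the dominating function for Fubini in `toeplitz_fockMonomial`, where the reproducing
kernel grows like `exp (‖w‖ ‖z‖)`. The power is bounded by `m! exp ‖w‖`, and completing the square
absorbs the linear exponent into half of the Gaussian weight. -/
theorem integrable_pow_mul_exp_radialMeasure (m : ℕ) (c : ℝ) :
    Integrable (fun w : ℂ => ‖w‖ ^ m * Real.exp (‖w‖ * c)) (radialMeasure 0) := by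
  rw [integrable_radialMeasure_iff]
  have h := (GaussianFourier.integrable_cexp_neg_mul_sq_norm_add (V := ℂ) (b := 1 / 2)
    (by norm_num) 0 0).norm
  refine (h.const_mul (m.factorial * Real.exp ((c + 1) ^ 2 / 2) * Real.pi⁻¹)).mono'
    (by fun_prop) ?_
  filter_upwards with w
  have e : ‖Complex.exp (-(1 / 2) * (‖w‖ : ℂ) ^ 2 + 0 * ((inner ℝ 0 w : ℝ) : ℂ))‖
      = Real.exp (-(‖w‖ ^ 2 / 2)) := by
    rw [Complex.norm_exp]
    congr 1
    have : (-(1 / 2) * (‖w‖ : ℂ) ^ 2 + 0 * ((inner ℝ 0 w : ℝ) : ℂ))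
        = ((-(‖w‖ ^ 2 / 2) : ℝ) : ℂ) := by
      push_cast; ring
    rw [this, Complex.ofReal_re]
  rw [e, Real.norm_of_nonneg (by positivity)]
  have hp := Real.pow_div_factorial_le_exp ‖w‖ (by positivity) m
  rw [div_le_iff₀ (by positivity)] at hp
  simp only [mul_zero, pow_zero, one_mul, Nat.factorial_zero, Nat.cast_one, mul_one]
  calc ‖w‖ ^ m * Real.exp (‖w‖ * c) * (Real.pi⁻¹ * Real.exp (-‖w‖ ^ 2))
      ≤ (Real.exp ‖w‖ * m.factorial) * Real.exp (‖w‖ * c) *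
          (Real.pi⁻¹ * Real.exp (-‖w‖ ^ 2)) := by gcongr
    _ = m.factorial * Real.pi⁻¹ * Real.exp (‖w‖ + ‖w‖ * c + -‖w‖ ^ 2) := by
        rw [Real.exp_add, Real.exp_add]; ring
    _ ≤ m.factorial * Real.pi⁻¹ * Real.exp ((c + 1) ^ 2 / 2 + -(‖w‖ ^ 2 / 2)) := by
        refine mul_le_mul_of_nonneg_left (Real.exp_le_exp.2 ?_) (by positivity)
        nlinarith [sq_nonneg (‖w‖ - (c + 1))]
    _ = _ := by rw [Real.exp_add]; ring

theorem IsSeparatelyRadialSymbol.exists_bound {k : ℕ} {φ : (Fin k → ℂ) → ℂ}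
    (hφ : IsSeparatelyRadialSymbol φ) : ∃ M : ℝ, 0 ≤ M ∧ ∀ᵐ w, ‖φ w‖ ≤ M := by
  refine ⟨(eLpNormEssSup φ volume).toReal, ENNReal.toReal_nonneg, ?_⟩
  filter_upwards [ae_le_eLpNormEssSup (f := φ) (μ := volume)] with w hw
  have h := hφ.essBounded.2
  rw [eLpNorm_exponent_top] at h
  have := ENNReal.toReal_mono h.ne hw
  simpa using this

instance (k : ℕ) : IsProbabilityMeasure (gaussianMeasure k) := by
  rw [gaussianMeasure_eq_pi]; infer_instance

/-- The Gaussian measure and `φ` are both invariant under coordinatewise rotation, so rotating the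
rest of the integrand by `θ` leaves the integral unchanged. Averaging over `θ` and exchanging
integrals leaves a torus integral that factors over the coordinates. By Cauchy's formula each factor
is `zᵢ^mᵢ` times `|wᵢ|^(2 mᵢ) / mᵢ!`, the density of `radialMeasure (m i)` relative to
`radialMeasure 0`. -/
theorem toeplitz_fockMonomial {k : ℕ} {φ : (Fin k → ℂ) → ℂ} (hφ : IsSeparatelyRadialSymbol φ)
    (m : Fin k → ℕ) (z : Fin k → ℂ) :
    toeplitz φ (fockMonomial m) z =
      (∫ w, φ w ∂Measure.pi fun i => radialMeasure (m i)) * ∏ i, z i ^ m i := by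
  obtain ⟨M, hM0, hM⟩ := hφ.exists_bound
  set F : (Fin k → ℝ) → (Fin k → ℂ) → ℂ := fun θ w => φ w * ∏ i,
    (((Circle.exp (-(θ i)) : ℂ) * w i) ^ m i *
      Complex.exp (conj ((Circle.exp (-(θ i)) : ℂ) * w i) * z i)) with hF
  have hJ : ∀ θ, ∫ w, F θ w ∂gaussianMeasure k = toeplitz φ (fockMonomial m) z := by
    intro θ
    have hp : MeasurePreserving
        (fun (w : Fin k → ℂ) i => (Circle.exp (-(θ i)) : ℂ) * w i)
        (gaussianMeasure k) (gaussianMeasure k) := by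
      rw [gaussianMeasure_eq_pi]
      exact measurePreserving_pi _ _ fun i => measurePreserving_rotation (Circle.exp (-(θ i))) 0
    have he : MeasurableEmbedding
        (fun (w : Fin k → ℂ) i => (Circle.exp (-(θ i)) : ℂ) * w i) :=
      (Homeomorph.piCongrRight fun i =>
        (rotation (Circle.exp (-(θ i)))).toHomeomorph).measurableEmbedding
    rw [toeplitz, bergmanProjection]
    refine Eq.trans ?_ (hp.integral_comp he _)
    congr 1; ext w
    rw [hφ.invariant (fun i => Circle.exp (-(θ i))) w]
    simp only [hF, fockMonomial, kernel, Finset.prod_mul_distrib, ← Complex.exp_sum,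
      ← Complex.exp_conj, map_sum, map_mul, Complex.conj_conj]
    ring
  have hI : ∀ w, ∫ θ, F θ w ∂(Measure.pi fun _ : Fin k => angleMeasure) =
      (∏ i, z i ^ m i) * (((∏ i, ‖w i‖ ^ (2 * m i) / (m i).factorial : ℝ) : ℂ) * φ w) := by
    intro w
    simp only [hF]
    rw [integral_const_mul, integral_fintype_prod_eq_prod (μ := fun _ => angleMeasure)
      (f := fun i (θ : ℝ) => ((Circle.exp (-θ) : ℂ) * w i) ^ m i *
        Complex.exp (conj ((Circle.exp (-θ) : ℂ) * w i) * z i))]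
    have : ∀ i, ∫ θ, ((Circle.exp (-θ) : ℂ) * w i) ^ m i *
        Complex.exp (conj ((Circle.exp (-θ) : ℂ) * w i) * z i) ∂angleMeasure =
        z i ^ m i * ((‖w i‖ ^ (2 * m i) / (m i).factorial : ℝ) : ℂ) := by
      intro i
      have h := integral_angleMeasure_exp (m i) (conj (w i) * z i)
      calc _ = ∫ θ, w i ^ m i * (((Circle.exp (-θ) : ℂ)) ^ m i *
            Complex.exp (conj (Circle.exp (-θ) : ℂ) * (conj (w i) * z i))) ∂angleMeasure := by
            congr 1; ext θ; rw [map_mul, mul_pow]; ring_nf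
        _ = _ := by
          rw [integral_const_mul, h, pow_mul]
          push_cast
          rw [← Complex.mul_conj', mul_pow, mul_pow]
          ring
    simp_rw [this]
    rw [Finset.prod_mul_distrib, Complex.ofReal_prod]
    ring
  have hint : Integrable (Function.uncurry F)
      ((Measure.pi fun _ : Fin k => angleMeasure).prod (gaussianMeasure k)) := by
    have hg : Integrable (fun w : Fin k → ℂ => M * ∏ i, (‖w i‖ ^ m i * Real.exp (‖w i‖ * ‖z i‖)))
        (gaussianMeasure k) := by
      rw [gaussianMeasure_eq_pi]
      exact (Integrable.fintype_prod (μ := fun _ : Fin k => radialMeasure 0) fun i =>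
        integrable_pow_mul_exp_radialMeasure (m i) ‖z i‖).const_mul M
    refine (hg.comp_snd _).mono' ?_ ?_
    · have := hφ.measurable
      refine Measurable.aestronglyMeasurable ?_
      simp only [hF, Function.uncurry_def]
      fun_prop
    · have h1 : ∀ᵐ w ∂gaussianMeasure k, ‖φ w‖ ≤ M :=
        (withDensity_absolutelyContinuous _ _).ae_le hM
      have h2 := (Measure.quasiMeasurePreserving_snd
        (μ := Measure.pi fun _ : Fin k => angleMeasure) (ν := gaussianMeasure k)).ae h1
      filter_upwards [h2] with p hp
      simp only [hF, Function.uncurry_def, norm_mul, norm_prod]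
      refine mul_le_mul hp (Finset.prod_le_prod (fun i _ => by positivity) fun i _ => ?_)
        (Finset.prod_nonneg fun i _ => by positivity) hM0
      rw [norm_pow, norm_mul, Circle.norm_coe, one_mul]
      gcongr
      rw [Complex.norm_exp]
      refine Real.exp_le_exp.2 ((Complex.re_le_norm _).trans ?_)
      simp
  have hsw := integral_integral_swap (f := F) hint
  simp_rw [hJ, hI] at hsw
  rw [integral_const_mul, ← integral_pi_radialMeasure] at hsw
  simp only [integral_const, probReal_univ, one_smul] at hsw
  rw [hsw, mul_comm]

theorem isEigenvalueFunction_iff {k : ℕ} {φ : (Fin k → ℂ) → ℂ}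
    (hφ : IsSeparatelyRadialSymbol φ) (γ : (Fin k → ℕ) → ℂ) :
    IsEigenvalueFunction φ γ ↔
      ∀ m, γ m = ∫ w, φ w ∂Measure.pi fun i => radialMeasure (m i) := by
  constructor
  · intro h m
    -- At the point `(1, …, 1)` the monomial equals `1`, which isolates the scalar.
    have h1 := congrFun (h m (fockMonomial m) (Submodule.mem_span_singleton_self _)) 1
    rw [toeplitz_fockMonomial hφ] at h1
    simpa [fockMonomial] using h1.symm
  · intro h m f hf
    obtain ⟨c, rfl⟩ := Submodule.mem_span_singleton.1 hf
    ext z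
    have : toeplitz φ (c • fockMonomial m) z = c * toeplitz φ (fockMonomial m) z := by
      simp only [toeplitz, bergmanProjection, ← integral_const_mul]
      congr 1; ext w
      simp only [Submodule.coe_smul, Pi.smul_apply, smul_eq_mul]
      ring
    rw [this, toeplitz_fockMonomial hφ, h m]
    simp only [Submodule.coe_smul, Pi.smul_apply, smul_eq_mul, fockMonomial]
    ring

/-! ### Lipschitz continuity of eigenvalue functions -/

theorem radialMeasure_succ (m : ℕ) :
    radialMeasure (m + 1) = (radialMeasure m).withDensity
      fun w => ENNReal.ofReal (‖w‖ ^ 2 / (m + 1)) := by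
  rw [radialMeasure, radialMeasure, ← withDensity_mul _ (by fun_prop) (by fun_prop)]
  congr 1
  ext w
  simp only [Pi.mul_apply]
  rw [← ENNReal.ofReal_mul (by positivity)]
  congr 1
  rw [Nat.factorial_succ, mul_add, pow_add]
  push_cast
  field_simp

theorem integrable_ratio_sub_one (m : ℕ) :
    Integrable (fun w => ‖w‖ ^ 2 / (m + 1) - 1) (radialMeasure m) := by
  have h1 := integrable_norm_pow_radialMeasure m 1
  exact (h1.div_const _).sub (integrable_const _)

/-- Under `radialMeasure m` the variable `‖w‖ ^ 2` has mean and variance `m + 1`, so `X = ‖w‖ ^ 2 /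
(m + 1) - 1` has second moment `1 / c ^ 2` with `c = √(m + 1)`. Integrating `|X| ≤ c X ^ 2 / 2 + 1 /
(2 c)` gives `1 / c`. Finally `(c - √m) (c + √m) = 1` and `c + √m ≤ 2 c` turn this into an increment
of the square root. -/
theorem integral_abs_ratio_sub_one_le (m : ℕ) :
    ∫ w, |‖w‖ ^ 2 / (m + 1) - 1| ∂radialMeasure m ≤ 2 * (√((m : ℝ) + 1) - √m) := by
  set c := √((m : ℝ) + 1) with hc
  have hc2 : c ^ 2 = m + 1 := Real.sq_sqrt (by positivity)
  have hcpos : 0 < c := Real.sqrt_pos.2 (by positivity)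
  have hs2 : √(m : ℝ) ^ 2 = m := Real.sq_sqrt (by positivity)
  have h1 := integrable_norm_pow_radialMeasure m 1
  have h2 := integrable_norm_pow_radialMeasure m 2
  have e1 := integral_norm_pow_radialMeasure m 1
  have e2 := integral_norm_pow_radialMeasure m 2
  have hle : ∫ w, |‖w‖ ^ 2 / (m + 1) - 1| ∂radialMeasure m ≤
      ∫ w, (c / (2 * (m + 1) ^ 2) * ‖w‖ ^ (2 * 2) - c / (m + 1) * ‖w‖ ^ (2 * 1) +
        (c / 2 + (2 * c)⁻¹)) ∂radialMeasure m := by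
    refine integral_mono (integrable_ratio_sub_one m).abs
      (((h2.const_mul _).sub (h1.const_mul _)).add (integrable_const _)) fun w => ?_
    have key : ∀ x : ℝ, |x| ≤ c / 2 * x ^ 2 + (2 * c)⁻¹ := by
      intro x
      have : c / 2 * x ^ 2 + (2 * c)⁻¹ - |x| = (c * |x| - 1) ^ 2 / (2 * c) := by
        rw [← sq_abs x]; field_simp; ring
      have h3 : 0 ≤ (c * |x| - 1) ^ 2 / (2 * c) := by positivity
      linarith
    refine (key _).trans (le_of_eq ?_)
    field_simp
    ring
  refine hle.trans ?_
  have h3 : Integrable (fun w => c / (2 * (m + 1) ^ 2) * ‖w‖ ^ (2 * 2) -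
    c / (m + 1) * ‖w‖ ^ (2 * 1)) (radialMeasure m) := (h2.const_mul _).sub (h1.const_mul _)
  rw [integral_add h3 (integrable_const _), integral_sub (h2.const_mul _) (h1.const_mul _),
    integral_const_mul, integral_const_mul, e1, e2]
  simp only [integral_const, probReal_univ, one_smul]
  have f1 : ((m + 1).factorial : ℝ) / m.factorial = c ^ 2 := by
    rw [hc2, Nat.factorial_succ]; push_cast; field_simp
  have f2 : ((m + 2).factorial : ℝ) / m.factorial = c ^ 2 * (c ^ 2 + 1) := by
    rw [hc2, Nat.factorial_succ, Nat.factorial_succ]; push_cast; field_simp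
  rw [f1, f2, ← hc2]
  have : c / (2 * (c ^ 2) ^ 2) * (c ^ 2 * (c ^ 2 + 1)) - c / c ^ 2 * c ^ 2 + (c / 2 + (2 * c)⁻¹)
      = 1 / c := by field_simp; ring
  rw [this, div_le_iff₀ hcpos]
  nlinarith [sq_nonneg (c - √(m : ℝ))]

theorem pi_radialMeasure_update {k : ℕ} (m : Fin k → ℕ) (i : Fin k) :
    Measure.pi (fun j => radialMeasure (Function.update m i (m i + 1) j)) =
      (Measure.pi fun j => radialMeasure (m j)).withDensity
        fun w => ENNReal.ofReal (‖w i‖ ^ 2 / (m i + 1)) := by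
  have h := pi_withDensity_ofReal (fun j => radialMeasure (m j))
    (f := fun j w => if j = i then ‖w‖ ^ 2 / (m j + 1) else 1) ?_ ?_
  · simp only [Finset.prod_ite_eq', Finset.mem_univ, if_true] at h
    rw [← h]
    congr 1; ext1 j
    by_cases hj : j = i
    · subst hj
      simp [radialMeasure_succ]
    · simp [hj]
  · intro j
    by_cases hj : j = i
    · simpa [hj] using (integrable_norm_pow_radialMeasure (m i) 1).div_const ((m i : ℝ) + 1)
    · simp [hj]
  · intro j w
    by_cases hj : j = i <;> simp only [hj, if_true, if_false] <;> positivity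

/-- The difference is the integral of `φ` times the density ratio minus `1`. That ratio depends on
the coordinate `i` alone, so the estimate reduces to one variable. -/
theorem norm_integral_update_sub_le {k : ℕ} {φ : (Fin k → ℂ) → ℂ} (hφ : Measurable φ) {M : ℝ}
    (hM : ∀ᵐ w, ‖φ w‖ ≤ M) (m : Fin k → ℕ) (i : Fin k) :
    ‖∫ w, φ w ∂Measure.pi (fun j => radialMeasure (Function.update m i (m i + 1) j)) -
      ∫ w, φ w ∂Measure.pi (fun j => radialMeasure (m j))‖ ≤
      M * (2 * (√((m i : ℝ) + 1) - √(m i))) := by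
  set P := Measure.pi (fun j => radialMeasure (m j)) with hP
  have hMP : ∀ᵐ w ∂P, ‖φ w‖ ≤ M := (pi_radialMeasure_absolutelyContinuous m).ae_le hM
  have hM0 : 0 ≤ M := by
    obtain ⟨w, hw⟩ := hMP.exists
    exact (norm_nonneg _).trans hw
  have hφP : Integrable φ P := Integrable.of_bound hφ.aestronglyMeasurable M hMP
  have hr : Integrable (fun w : Fin k → ℂ => ‖w i‖ ^ 2 / (m i + 1) - 1) P :=
    integrable_comp_eval (μ := fun j => radialMeasure (m j)) (i := i)
      (integrable_ratio_sub_one (m i))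
  have hd : Integrable (fun w : Fin k → ℂ => (‖w i‖ ^ 2 / (m i + 1) - 1) • φ w) P :=
    hr.smul_bdd M hφ.aestronglyMeasurable hMP
  rw [pi_radialMeasure_update, integral_withDensity_eq_integral_toReal_smul (by fun_prop) (by simp)]
  have e : ∀ w : Fin k → ℂ, (ENNReal.ofReal (‖w i‖ ^ 2 / (m i + 1))).toReal • φ w =
      (‖w i‖ ^ 2 / (m i + 1) - 1) • φ w + φ w := by
    intro w
    rw [ENNReal.toReal_ofReal (by positivity), sub_smul, one_smul, sub_add_cancel]
  simp_rw [e]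
  rw [integral_add hd hφP, add_sub_cancel_right]
  calc _ ≤ ∫ w, M * |‖w i‖ ^ 2 / (m i + 1) - 1| ∂P := by
        refine norm_integral_le_of_norm_le (hr.abs.const_mul M) ?_
        filter_upwards [hMP] with w hw
        rw [norm_smul, Real.norm_eq_abs, mul_comm]
        gcongr
    _ = M * ∫ w, |‖w‖ ^ 2 / (m i + 1) - 1| ∂radialMeasure (m i) := by
        rw [integral_const_mul]
        congr 1
        exact integral_comp_eval (μ := fun j => radialMeasure (m j)) (i := i)
          (f := fun w => |‖w‖ ^ 2 / (m i + 1) - 1|)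
          (integrable_ratio_sub_one (m i)).abs.aestronglyMeasurable
    _ ≤ _ := by
        gcongr
        exact integral_abs_ratio_sub_one_le (m i)

/-- Increments of the square root telescope along a coordinate line, so unit steps add up to `|√a -
√b|` without loss. Replacing the coordinates of `m'` by those of `m` one at a time then gives the
sum over all coordinates. -/
theorem norm_sub_le_sqrtDist_of_step {k : ℕ} {γ : (Fin k → ℕ) → ℂ} {C : ℝ}
    (h : ∀ m i, ‖γ (Function.update m i (m i + 1)) - γ m‖ ≤ C * (√((m i : ℝ) + 1) - √(m i)))
    (m m' : Fin k → ℕ) : ‖γ m - γ m'‖ ≤ C * sqrtDist m m' := by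
  have h1 : ∀ (m : Fin k → ℕ) i (d : ℕ), ‖γ (Function.update m i (m i + d)) - γ m‖ ≤
      C * (√((m i : ℝ) + d) - √(m i)) := by
    intro m i d
    induction d with
    | zero => simp
    | succ d ih =>
      have h2 := h (Function.update m i (m i + d)) i
      simp only [Function.update_self, Function.update_idem] at h2
      have := norm_sub_le_norm_sub_add_norm_sub (γ (Function.update m i (m i + d + 1)))
        (γ (Function.update m i (m i + d))) (γ m)
      rw [← add_assoc]
      push_cast at h2 ⊢
      rw [← add_assoc]
      linarith
  have h2 : ∀ (m : Fin k → ℕ) i (a : ℕ), ‖γ (Function.update m i a) - γ m‖ ≤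
      C * |√(a : ℝ) - √(m i)| := by
    intro m i a
    rcases le_total (m i) a with hle | hle
    · obtain ⟨d, rfl⟩ := Nat.exists_eq_add_of_le hle
      refine (h1 m i d).trans (le_of_eq ?_)
      push_cast
      rw [abs_of_nonneg]
      exact sub_nonneg.2 (Real.sqrt_le_sqrt (by simp))
    · obtain ⟨d, hd⟩ := Nat.exists_eq_add_of_le hle
      have h3 := h1 (Function.update m i a) i d
      simp only [Function.update_self, Function.update_idem, ← hd, Function.update_eq_self] at h3
      rw [norm_sub_rev, abs_sub_comm]
      refine h3.trans (le_of_eq ?_)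
      rw [hd]
      push_cast
      rw [abs_of_nonneg]
      exact sub_nonneg.2 (Real.sqrt_le_sqrt (by simp))
  have h3 : ∀ s : Finset (Fin k), ‖γ (s.piecewise m m') - γ m'‖ ≤
      C * ∑ i ∈ s, |√(m i : ℝ) - √(m' i)| := by
    intro s
    induction s using Finset.induction_on with
    | empty => simp
    | insert i s hi ih =>
      rw [Finset.sum_insert hi, Finset.piecewise_insert]
      have h4 := h2 (s.piecewise m m') i (m i)
      rw [Finset.piecewise_eq_of_notMem _ _ _ hi] at h4
      have := norm_sub_le_norm_sub_add_norm_sub (γ (Function.update (s.piecewise m m') i (m i)))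
        (γ (s.piecewise m m')) (γ m')
      rw [mul_add]
      linarith
  simpa [sqrtDist] using h3 Finset.univ

theorem exists_mem_Cbu_of_mem_eigenvalueFunctions {k : ℕ} {γ : (Fin k → ℕ) → ℂ}
    (hγ : γ ∈ eigenvalueFunctions k) : ∃ σ ∈ Cbu k, ⇑σ = γ := by
  obtain ⟨φ, hφ, hγ⟩ := hγ
  rw [isEigenvalueFunction_iff hφ] at hγ
  obtain ⟨M, hM0, hM⟩ := hφ.exists_bound
  have hb : ∀ m, ‖γ m‖ ≤ M := by
    intro m
    rw [hγ]
    have := norm_integral_le_of_norm_le_const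
      ((pi_radialMeasure_absolutelyContinuous m).ae_le hM)
    simpa using this
  have hL := norm_sub_le_sqrtDist_of_step (γ := γ) (C := 2 * M) fun m i => by
    rw [hγ, hγ]
    refine (norm_integral_update_sub_le hφ.measurable hM m i).trans (le_of_eq (by ring))
  refine ⟨BoundedContinuousFunction.ofNormedAddCommGroupDiscrete γ M hb, ?_, rfl⟩
  intro ε hε
  -- The Lipschitz constant is `2 * M`; the added `1` covers the case `M = 0`.
  refine ⟨ε / (2 * M + 1), by positivity, fun m m' h => ?_⟩
  refine (hL m m').trans_lt ?_
  rw [lt_div_iff₀ (by positivity)] at h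
  have : 0 ≤ sqrtDist m m' := Finset.sum_nonneg fun i _ => abs_nonneg _
  nlinarith

open Filter Topology Asymptotics

/-! ### The law of the modulus and its Gaussian limit -/

/-- The density of the law of `|w|` under `radialMeasure m`. -/
def modulusDensity (m : ℕ) : ℝ → ℝ :=
  (Set.Ioi 0).indicator fun x => 2 / m.factorial * x ^ (2 * m + 1) * Real.exp (-x ^ 2)

theorem modulusDensity_nonneg (m : ℕ) (x : ℝ) : 0 ≤ modulusDensity m x :=
  Set.indicator_nonneg (fun y (hy : 0 < y) => by positivity) x

@[fun_prop]
theorem measurable_modulusDensity (m : ℕ) : Measurable (modulusDensity m) :=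
  Measurable.indicator (by fun_prop) measurableSet_Ioi

theorem integral_comp_norm_radialMeasure {E : Type*} [NormedAddCommGroup E] [NormedSpace ℝ E]
    (m : ℕ) (b : ℝ → E) :
    ∫ w, b ‖w‖ ∂radialMeasure m = ∫ x, modulusDensity m x • b x := by
  rw [integral_radialMeasure, integral_fun_norm_addHaar (μ := (volume : Measure ℂ)) (fun x =>
    ((Real.pi * m.factorial)⁻¹ * (x ^ (2 * m) * Real.exp (-x ^ 2))) • b x)]
  have e1 : (volume : Measure ℂ).real (Metric.ball 0 1) = Real.pi := by
    simp [Measure.real]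
  have e2 : (fun x => modulusDensity m x • b x) = (Set.Ioi 0).indicator fun x =>
      (2 / m.factorial * x ^ (2 * m + 1) * Real.exp (-x ^ 2)) • b x := by
    ext x
    by_cases hx : x ∈ Set.Ioi (0 : ℝ) <;> simp [modulusDensity, hx]
  rw [e1, e2, integral_indicator measurableSet_Ioi, Complex.finrank_real_complex,
    ← Nat.cast_smul_eq_nsmul ℝ, smul_smul, ← integral_smul]
  congr 1; ext x
  rw [smul_smul, smul_smul]
  congr 1
  have := Real.pi_ne_zero
  field_simp
  push_cast
  ring

theorem integral_modulusDensity (m : ℕ) : ∫ x, modulusDensity m x = 1 := by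
  simpa using (integral_comp_norm_radialMeasure m fun _ => (1 : ℝ)).symm

theorem integrable_modulusDensity (m : ℕ) : Integrable (modulusDensity m) := by
  by_contra h
  have := integral_modulusDensity m
  rw [integral_undef h] at this
  exact zero_ne_one this

/-- The density of the centred Gaussian law with variance `1 / 4`. -/
def limitDensity (u : ℝ) : ℝ :=
  √(2 / Real.pi) * Real.exp (-2 * u ^ 2)

theorem limitDensity_nonneg (u : ℝ) : 0 ≤ limitDensity u := by
  unfold limitDensity; positivity

@[fun_prop]
theorem continuous_limitDensity : Continuous limitDensity := by
  unfold limitDensity; fun_prop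

theorem integrable_limitDensity : Integrable limitDensity :=
  (integrable_exp_neg_mul_sq (b := 2) (by norm_num)).const_mul _

theorem integral_limitDensity : ∫ u, limitDensity u = 1 := by
  simp only [limitDensity]
  rw [integral_const_mul, integral_gaussian, ← Real.sqrt_mul (by positivity),
    div_mul_div_cancel₀ Real.pi_ne_zero, div_self two_ne_zero, Real.sqrt_one]

/-- This is Scheffé's lemma. In `|f - g| = (f - g) + 2 (g - f)⁺` the first term has integral zero,
and the second is dominated by `g`. -/
theorem tendsto_integral_abs_sub_of_tendsto {α : Type*} [MeasurableSpace α] {μ : Measure α}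
    {f : ℕ → α → ℝ} {g : α → ℝ} (hf : ∀ n, Integrable (f n) μ) (hg : Integrable g μ)
    (hf0 : ∀ n x, 0 ≤ f n x) (hg0 : ∀ x, 0 ≤ g x)
    (hint : ∀ n, ∫ x, f n x ∂μ = ∫ x, g x ∂μ)
    (hlim : ∀ x, Tendsto (fun n => f n x) atTop (𝓝 (g x))) :
    Tendsto (fun n => ∫ x, |f n x - g x| ∂μ) atTop (𝓝 0) := by
  have h1 : ∀ n, ∫ x, |f n x - g x| ∂μ = 2 * ∫ x, max (g x - f n x) 0 ∂μ := by
    intro n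
    have hm : Integrable (fun x => max (g x - f n x) 0) μ := (hg.sub (hf n)).pos_part
    have e : ∀ x, |f n x - g x| = (f n x - g x) + 2 * max (g x - f n x) 0 := by
      intro x
      rcases le_total (f n x) (g x) with h | h
      · rw [abs_of_nonpos (by linarith), max_eq_left (by linarith)]; ring
      · rw [abs_of_nonneg (by linarith), max_eq_right (by linarith)]; ring
    simp_rw [e]
    have hs : Integrable (fun x => f n x - g x) μ := (hf n).sub hg
    rw [integral_add hs (hm.const_mul 2), integral_sub (hf n) hg, hint,
      sub_self, zero_add, integral_const_mul]
  simp_rw [h1]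
  have h2 : Tendsto (fun n => ∫ x, max (g x - f n x) 0 ∂μ) atTop (𝓝 (∫ _x, (0 : ℝ) ∂μ)) := by
    refine tendsto_integral_of_dominated_convergence g
      (fun n => ((hg.sub (hf n)).pos_part).aestronglyMeasurable) hg ?_ ?_
    · intro n
      refine .of_forall fun x => ?_
      rw [Real.norm_of_nonneg (le_max_right _ _)]
      exact max_le (by linarith [hf0 n x]) (hg0 x)
    · refine .of_forall fun x => ?_
      have := ((tendsto_const_nhds (x := g x)).sub (hlim x)).max (tendsto_const_nhds (x := (0:ℝ)))
      simpa using this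
  simpa using h2.const_mul 2

/-- With `x = u / √m`, the terms `2 m (x - x² / 2)` of the expansion equal `2 u √m - u²`. The
remainder is `2 m` times a quantity of order `|x|³`, and the one extra logarithm tends to zero. -/
theorem tendsto_log_one_add_div_sqrt (u : ℝ) :
    Tendsto (fun m : ℕ => (2 * m + 1) * Real.log (1 + u / √m) - 2 * u * √m - u ^ 2) atTop
      (𝓝 (-2 * u ^ 2)) := by
  have hs : Tendsto (fun m : ℕ => √(m : ℝ)) atTop atTop :=
    Real.tendsto_sqrt_atTop.comp tendsto_natCast_atTop_atTop
  have hx : Tendsto (fun m : ℕ => u / √(m : ℝ)) atTop (𝓝 0) := hs.const_div_atTop u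
  have hax : Tendsto (fun m : ℕ => |u / √(m : ℝ)|) atTop (𝓝 0) := by simpa using hx.abs
  have hlog : Tendsto (fun m : ℕ => Real.log (1 + u / √(m : ℝ))) atTop (𝓝 0) := by
    have h1 : Tendsto (fun m : ℕ => 1 + u / √(m : ℝ)) atTop (𝓝 1) := by
      simpa using hx.const_add 1
    simpa using h1.log one_ne_zero
  have hrem : Tendsto (fun m : ℕ => (2 * m) * (Real.log (1 + u / √m) - u / √m +
      (u / √m) ^ 2 / 2)) atTop (𝓝 0) := by
    have hb : Tendsto (fun m : ℕ => 2 * u ^ 2 * (|u / √(m : ℝ)| / (1 - |u / √(m : ℝ)|))) atTop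
        (𝓝 0) := by
      have := (hax.div ((tendsto_const_nhds (x := (1:ℝ))).sub hax) (by norm_num)).const_mul
        (2 * u ^ 2)
      simpa using this
    refine squeeze_zero_norm' ?_ hb
    filter_upwards [hax.eventually_lt_const one_pos, eventually_gt_atTop 0] with m hm hm0
    have hm1 : (0 : ℝ) < m := by exact_mod_cast hm0
    have h := Real.abs_log_sub_add_sum_range_le (x := -(u / √(m : ℝ))) (by rwa [abs_neg]) 2
    rw [Finset.sum_range_succ, Finset.sum_range_one, abs_neg] at h
    have e1 : Real.log (1 + u / √m) - u / √m + (u / √m) ^ 2 / 2 =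
      (-(u / √(m : ℝ))) ^ (0 + 1) / (((0 : ℕ) : ℝ) + 1) +
        (-(u / √(m : ℝ))) ^ (1 + 1) / (((1 : ℕ) : ℝ) + 1) + Real.log (1 - -(u / √(m : ℝ))) := by
      rw [sub_neg_eq_add]; push_cast; ring
    rw [e1, norm_mul, Real.norm_eq_abs, Real.norm_eq_abs,
      abs_of_pos (by positivity : (0 : ℝ) < 2 * m)]
    refine (mul_le_mul_of_nonneg_left h (by positivity)).trans (le_of_eq ?_)
    have e2 : (m : ℝ) * |u / √(m : ℝ)| ^ 2 = u ^ 2 := by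
      rw [sq_abs, div_pow, Real.sq_sqrt hm1.le]; field_simp
    calc 2 * (m : ℝ) * (|u / √(m : ℝ)| ^ (2 + 1) / (1 - |u / √(m : ℝ)|)) =
          2 * (m * |u / √(m : ℝ)| ^ 2) * (|u / √(m : ℝ)| / (1 - |u / √(m : ℝ)|)) := by ring
      _ = _ := by rw [e2]
  have := (hrem.add hlog).sub_const (2 * u ^ 2)
  simp only [add_zero, zero_sub] at this
  rw [show -2 * u ^ 2 = -(2 * u ^ 2) by ring]
  refine this.congr' ?_
  filter_upwards [eventually_gt_atTop 0] with m hm0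
  have hm1 : (0 : ℝ) < m := by exact_mod_cast hm0
  have e3 : (m : ℝ) * (u / √(m : ℝ)) ^ 2 = u ^ 2 := by
    rw [div_pow, Real.sq_sqrt hm1.le]; field_simp
  have e4 : (m : ℝ) * (u / √(m : ℝ)) = u * √m := by
    rw [mul_div_assoc', div_eq_iff (by positivity)]
    linear_combination (-u) * Real.mul_self_sqrt hm1.le
  linear_combination e3 - 2 * e4

/-- Once `√m + u` is positive, the density is exactly `√(2 / π)` times the ratio of Stirling's
approximation to `m!` times the exponential of the expression in `tendsto_log_one_add_div_sqrt`. -/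
theorem tendsto_modulusDensity (u : ℝ) :
    Tendsto (fun m : ℕ => modulusDensity m (√m + u)) atTop (𝓝 (limitDensity u)) := by
  have hs : Tendsto (fun m : ℕ => √(m : ℝ)) atTop atTop :=
    Real.tendsto_sqrt_atTop.comp tendsto_natCast_atTop_atTop
  have h1 := (Real.continuous_exp.tendsto _).comp (tendsto_log_one_add_div_sqrt u)
  have h2 : Tendsto (fun n : ℕ => √(2 * n * Real.pi) * (n / Real.exp 1) ^ n / n.factorial) atTop
      (𝓝 1) := by
    have := (isEquivalent_iff_tendsto_one
      (.of_forall fun n => by positivity)).1 Stirling.factorial_isEquivalent_stirling.symm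
    exact this
  have h3 := (h2.mul h1).const_mul √(2 / Real.pi)
  rw [one_mul] at h3
  refine h3.congr' ?_
  filter_upwards [eventually_gt_atTop 0, hs.eventually_gt_atTop (-u)] with m hm0 hmu
  have hm1 : (0 : ℝ) < m := by exact_mod_cast hm0
  have hsm : 0 < √(m : ℝ) := by positivity
  have hx : 0 < √(m : ℝ) + u := by linarith
  have hfac : √(m : ℝ) + u = √m * (1 + u / √m) := by field_simp
  have hy : 0 < 1 + u / √(m : ℝ) := by
    rw [hfac] at hx
    exact pos_of_mul_pos_right hx hsm.le
  have hmem : √(m : ℝ) + u ∈ Set.Ioi (0 : ℝ) := hx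
  rw [modulusDensity, Set.indicator_of_mem hmem, Function.comp_apply]
  have e1 : Real.exp ((2 * m + 1) * Real.log (1 + u / √m) - 2 * u * √m - u ^ 2) =
      (1 + u / √m) ^ (2 * m + 1) * Real.exp (-2 * u * √m - u ^ 2) := by
    rw [← Real.exp_log (pow_pos hy (2 * m + 1)), ← Real.exp_add, Real.log_pow]
    push_cast; ring_nf
  have e2 : (√(m : ℝ) + u) ^ (2 * m + 1) = m ^ m * √m * (1 + u / √m) ^ (2 * m + 1) := by
    rw [hfac, mul_pow, pow_succ (√(m : ℝ)), pow_mul, Real.sq_sqrt hm1.le]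
  have e3 : Real.exp (-(√(m : ℝ) + u) ^ 2) =
      (Real.exp 1 ^ m)⁻¹ * Real.exp (-2 * u * √m - u ^ 2) := by
    rw [← Real.exp_nat_mul, ← Real.exp_neg, ← Real.exp_add]
    congr 1
    linear_combination -Real.sq_sqrt hm1.le
  have e4 : √(2 / Real.pi) * √(2 * m * Real.pi) = 2 * √m := by
    rw [← Real.sqrt_mul (by positivity), show 2 / Real.pi * (2 * m * Real.pi) = 2 ^ 2 * m by
      have := Real.pi_ne_zero; field_simp, Real.sqrt_mul (by norm_num),
      Real.sqrt_sq (by norm_num)]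
  rw [e1, e2, e3, div_pow]
  calc _ = (√(2 / Real.pi) * √(2 * m * Real.pi)) * (m ^ m / Real.exp 1 ^ m / m.factorial) *
        ((1 + u / √m) ^ (2 * m + 1) * Real.exp (-2 * u * √m - u ^ 2)) := by ring
    _ = _ := by rw [e4]; ring

theorem tendsto_integral_abs_modulusDensity_sub :
    Tendsto (fun m : ℕ => ∫ u, |modulusDensity m (√m + u) - limitDensity u|) atTop (𝓝 0) := by
  refine tendsto_integral_abs_sub_of_tendsto
    (fun m => (integrable_modulusDensity m).comp_add_left _) integrable_limitDensity
    (fun m u => modulusDensity_nonneg m _) limitDensity_nonneg (fun m => ?_)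
    tendsto_modulusDensity
  rw [integral_add_left_eq_self, integral_modulusDensity, integral_limitDensity]

/-! ### Deconvolution of the Gaussian -/

open FourierTransform ContDiff in
-- The Fourier transform of `limitDensity` is `exp (-π² ξ² / 2)`. Dividing the cutoff `χ (ξ / R)` by
-- it leaves a smooth compactly supported function, and `h` is the inverse transform of the
-- quotient. Smoothing `h` by the Gaussian restores `χ (ξ / R)` on the Fourier side, which is the
-- rescaling by `R` of `Φ = 𝓕⁻ χ`. The integral of `Φ` is `χ 0 = 1`.
theorem exists_gaussian_deconvolution :
    ∃ Φ : ℝ → ℂ, Integrable Φ ∧ ∫ v, Φ v = 1 ∧ ∀ R : ℝ, 0 < R →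
      ∃ h : ℝ → ℂ, Continuous h ∧ Integrable h ∧
        ∀ v, ∫ u, (limitDensity u : ℂ) * h (v + u) = R * Φ (R * v) := by
  let χ : ContDiffBump (0 : ℝ) := ⟨1, 2, one_pos, one_lt_two⟩
  have hχs : HasCompactSupport fun ξ => (χ ξ : ℂ) :=
    χ.hasCompactSupport.comp_left (g := fun x : ℝ => (x : ℂ)) Complex.ofReal_zero
  have hχd : ContDiff ℝ ∞ fun ξ => (χ ξ : ℂ) := Complex.ofRealCLM.contDiff.comp χ.contDiff
  let X : SchwartzMap ℝ ℂ := hχs.toSchwartzMap hχd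
  let Y : SchwartzMap ℝ ℂ := 𝓕⁻ X
  refine ⟨Y, Y.integrable, ?_, fun R hR => ?_⟩
  · have h1 : 𝓕 Y = X := FourierTransform.fourier_fourierInv_eq X
    have h2 : 𝓕 Y 0 = ∫ v, Y v := by
      rw [SchwartzMap.fourier_coe, Real.fourier_eq']
      simp
    rw [← h2, h1]
    have : χ 0 = 1 := χ.one_of_mem_closedBall (by simp [χ])
    simp [X, this]
  · have hds : HasCompactSupport fun ξ : ℝ =>
        (χ (ξ / R) : ℂ) * Complex.exp (Real.pi ^ 2 * ξ ^ 2 / 2) := by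
      refine HasCompactSupport.mul_right (f := fun ξ : ℝ => (χ (ξ / R) : ℂ)) ?_
      exact hχs.comp_homeomorph (Homeomorph.mulRight₀ R⁻¹ (inv_ne_zero hR.ne'))
    have hdd : ContDiff ℝ ∞ fun ξ : ℝ => (χ (ξ / R) : ℂ) * Complex.exp (Real.pi ^ 2 * ξ ^ 2 / 2) := by
      have h1 : ContDiff ℝ ∞ fun ξ : ℝ => (χ (ξ / R) : ℂ) :=
        hχd.comp (contDiff_id.div_const R)
      have h2 : ContDiff ℝ ∞ fun ξ : ℝ => (ξ : ℂ) := Complex.ofRealCLM.contDiff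
      fun_prop
    let H : SchwartzMap ℝ ℂ := hds.toSchwartzMap hdd
    have hH : ∀ ξ, H ξ = (χ (ξ / R) : ℂ) * Complex.exp (Real.pi ^ 2 * ξ ^ 2 / 2) := fun ξ => rfl
    let G : SchwartzMap ℝ ℂ := 𝓕⁻ H
    refine ⟨G, G.continuous, G.integrable, fun v => ?_⟩
    have hg := integrable_limitDensity.ofReal (𝕜 := ℂ)
    have e1 : ∀ x, G x = ∫ ξ, Complex.exp ((2 * Real.pi * (ξ * x) : ℝ) * Complex.I) * H ξ := by
      intro x
      rw [show ⇑G = 𝓕⁻ ⇑H from SchwartzMap.fourierInv_coe _, Real.fourierInv_eq']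
      simp [mul_comm x]
    have e2 : ∀ x, Y x = ∫ ξ, Complex.exp ((2 * Real.pi * (ξ * x) : ℝ) * Complex.I) * χ ξ := by
      intro x
      rw [show ⇑Y = 𝓕⁻ ⇑X from SchwartzMap.fourierInv_coe _, Real.fourierInv_eq']
      simp [mul_comm x, X]
    have hint : Integrable (Function.uncurry fun u ξ : ℝ => (limitDensity u : ℂ) *
        (Complex.exp ((2 * Real.pi * (ξ * (v + u)) : ℝ) * Complex.I) * H ξ))
        (volume.prod volume) := by
      refine (hg.mul_prod H.integrable).mono (by
        refine Measurable.aestronglyMeasurable ?_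
        have := H.continuous.measurable
        simp only [Function.uncurry_def]
        fun_prop) ?_
      refine .of_forall fun p => ?_
      simp only [Function.uncurry_def, norm_mul, Complex.norm_exp_ofReal_mul_I, one_mul]
      exact le_rfl
    calc ∫ u, (limitDensity u : ℂ) * G (v + u)
        = ∫ u, ∫ ξ, (limitDensity u : ℂ) *
            (Complex.exp ((2 * Real.pi * (ξ * (v + u)) : ℝ) * Complex.I) * H ξ) := by
          simp_rw [e1, integral_const_mul]
      _ = ∫ ξ, ∫ u, (limitDensity u : ℂ) *
            (Complex.exp ((2 * Real.pi * (ξ * (v + u)) : ℝ) * Complex.I) * H ξ) :=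
          integral_integral_swap hint
      _ = ∫ ξ, Complex.exp ((2 * Real.pi * (ξ * v) : ℝ) * Complex.I) * χ (ξ / R) := by
          congr 1; ext ξ
          have h := fourierIntegral_gaussian (b := 2) (by norm_num) (2 * Real.pi * ξ)
          have h2 : ∀ u : ℝ, (limitDensity u : ℂ) *
              (Complex.exp ((2 * Real.pi * (ξ * (v + u)) : ℝ) * Complex.I) * H ξ) =
              (√(2 / Real.pi) : ℝ) * Complex.exp ((2 * Real.pi * (ξ * v) : ℝ) * Complex.I) * H ξ *
              (Complex.exp (Complex.I * (2 * Real.pi * ξ) * u) * Complex.exp (-2 * u ^ 2)) := by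
            intro u
            have : Complex.exp ((2 * Real.pi * (ξ * (v + u)) : ℝ) * Complex.I) =
                Complex.exp ((2 * Real.pi * (ξ * v) : ℝ) * Complex.I) *
                  Complex.exp (Complex.I * (2 * Real.pi * ξ) * u) := by
              rw [← Complex.exp_add]; congr 1; push_cast; ring
            rw [this, limitDensity]
            push_cast
            ring
          simp_rw [h2]
          rw [integral_const_mul, h, hH]
          have h3 : ((Real.pi : ℂ) / 2) ^ (1 / 2 : ℂ) = ((√(Real.pi / 2) : ℝ) : ℂ) := by
            rw [Real.sqrt_eq_rpow, Complex.ofReal_cpow (by positivity)]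
            push_cast; rfl
          have h4 : √(2 / Real.pi) * √(Real.pi / 2) = 1 := by
            rw [← Real.sqrt_mul (by positivity), div_mul_div_cancel₀ Real.pi_ne_zero,
              div_self two_ne_zero, Real.sqrt_one]
          have h5 : Complex.exp (Real.pi ^ 2 * ξ ^ 2 / 2) *
              Complex.exp (-(2 * Real.pi * ξ) ^ 2 / (4 * 2)) = 1 := by
            rw [← Complex.exp_add, ← Complex.exp_zero]; congr 1; ring
          rw [h3]
          have h6 : ((√(2 / Real.pi) : ℝ) : ℂ) * ((√(Real.pi / 2) : ℝ) : ℂ) = 1 := by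
            exact_mod_cast h4
          linear_combination (Complex.exp ((2 * Real.pi * (ξ * v) : ℝ) * Complex.I) * χ (ξ / R)) *
            ((Complex.exp (Real.pi ^ 2 * ξ ^ 2 / 2) *
              Complex.exp (-(2 * Real.pi * ξ) ^ 2 / (4 * 2))) * h6 + h5)
      _ = R * Y (R * v) := by
          rw [e2]
          have h := Measure.integral_comp_div (fun ξ : ℝ =>
            Complex.exp ((2 * Real.pi * (ξ * (R * v)) : ℝ) * Complex.I) * χ ξ) R
          rw [abs_of_pos hR, Complex.real_smul] at h
          rw [← h]
          congr 1; ext ξ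
          congr 4
          field_simp

/-! ### Kernels with uniformly summable rows -/

/-- A measurable kernel `s : I × X → ℂ` with `∑ₙ |s n x| ≤ C` for all `x`. -/
structure IsBoundedKernel {I X : Type*} [MeasurableSpace X] (s : I → X → ℂ) (C : ℝ) : Prop where
  measurable : ∀ n, Measurable (s n)
  summable : ∀ x, Summable fun n => ‖s n x‖
  tsum_le : ∀ x, ∑' n, ‖s n x‖ ≤ C

/-- The function `x ↦ ∑ₙ s n x * σ n` attached to a kernel `s` and a family `σ`. -/
def kernelSum {I X : Type*} (s : I → X → ℂ) (σ : I → ℂ) (x : X) : ℂ :=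
  ∑' n, s n x * σ n

section Kernel

theorem summable_mul_of_bounded {I : Type*} {a σ : I → ℂ} {B : ℝ}
    (ha : Summable fun n => ‖a n‖) (hσ : ∀ n, ‖σ n‖ ≤ B) : Summable fun n => ‖a n * σ n‖ := by
  refine Summable.of_nonneg_of_le (fun n => norm_nonneg _) (fun n => ?_) (ha.mul_right B)
  rw [norm_mul]
  exact mul_le_mul_of_nonneg_left (hσ n) (norm_nonneg _)

theorem norm_tsum_mul_le {I : Type*} {a σ : I → ℂ} {B : ℝ}
    (ha : Summable fun n => ‖a n‖) (hσ : ∀ n, ‖σ n‖ ≤ B) :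
    ‖∑' n, a n * σ n‖ ≤ (∑' n, ‖a n‖) * B := by
  have h := summable_mul_of_bounded ha hσ
  refine (norm_tsum_le_tsum_norm h).trans ?_
  rw [← tsum_mul_right]
  refine h.tsum_le_tsum (fun n => ?_) (ha.mul_right B)
  rw [norm_mul]
  exact mul_le_mul_of_nonneg_left (hσ n) (norm_nonneg _)

theorem integral_tsum_mul {I X : Type*} [Countable I] [MeasurableSpace X] {P : Measure X}
    [IsProbabilityMeasure P] {a : I → ℂ} {V : I → X → ℂ} {B : ℝ} (ha : Summable fun n => ‖a n‖)
    (hV : ∀ n, Measurable (V n)) (hB : ∀ n x, ‖V n x‖ ≤ B) :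
    ∫ x, ∑' n, a n * V n x ∂P = ∑' n, a n * ∫ x, V n x ∂P := by
  have hVi : ∀ n, Integrable (V n) P := fun n =>
    Integrable.of_bound (hV n).aestronglyMeasurable B (.of_forall (hB n))
  have h := hasSum_integral_of_summable_integral_norm (μ := P) (F := fun n x => a n * V n x)
    (fun n => (hVi n).const_mul (a n)) ?_
  · simp_rw [integral_const_mul] at h
    exact h.tsum_eq.symm
  · refine Summable.of_nonneg_of_le (fun n => integral_nonneg fun x => norm_nonneg _) (fun n => ?_)
      (ha.mul_right B)
    simp_rw [norm_mul]
    rw [integral_const_mul]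
    refine mul_le_mul_of_nonneg_left ?_ (norm_nonneg _)
    refine (integral_mono (hVi n).norm (integrable_const B) (hB n)).trans ?_
    simp

variable {I X : Type*} [MeasurableSpace X] {s : I → X → ℂ} {C B : ℝ} {σ : I → ℂ}

theorem measurable_kernelSum [Countable I] (hs : ∀ n, Measurable (s n)) :
    Measurable (kernelSum s σ) :=
  Measurable.tsum fun n => (hs n).mul_const _

theorem IsBoundedKernel.norm_kernelSum_le (hs : IsBoundedKernel s C) (hσ : ∀ n, ‖σ n‖ ≤ B)
    (hB : 0 ≤ B) (x : X) : ‖kernelSum s σ x‖ ≤ C * B :=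
  (norm_tsum_mul_le (hs.summable x) hσ).trans (mul_le_mul_of_nonneg_right (hs.tsum_le x) hB)

theorem IsBoundedKernel.norm_le (hs : IsBoundedKernel s C) (n : I) (x : X) : ‖s n x‖ ≤ C :=
  ((hs.summable x).le_tsum n fun _ _ => norm_nonneg _).trans (hs.tsum_le x)

theorem IsBoundedKernel.integrable (hs : IsBoundedKernel s C) (P : Measure X)
    [IsProbabilityMeasure P] (n : I) : Integrable (s n) P :=
  Integrable.of_bound (hs.measurable n).aestronglyMeasurable C (.of_forall (hs.norm_le n))

theorem IsBoundedKernel.integrable_kernelSum [Countable I] (hs : IsBoundedKernel s C)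
    (hσ : ∀ n, ‖σ n‖ ≤ B)
    (hB : 0 ≤ B) (P : Measure X) [IsProbabilityMeasure P] : Integrable (kernelSum s σ) P :=
  Integrable.of_bound (measurable_kernelSum hs.measurable).aestronglyMeasurable (C * B)
    (.of_forall (hs.norm_kernelSum_le hσ hB))

theorem IsBoundedKernel.norm_integral_kernelSum_le (hs : IsBoundedKernel s C)
    (hσ : ∀ n, ‖σ n‖ ≤ B) (hB : 0 ≤ B) (P : Measure X) [IsProbabilityMeasure P] :
    ‖∫ x, kernelSum s σ x ∂P‖ ≤ C * B := by
  have := norm_integral_le_of_norm_le_const (μ := P)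
    (.of_forall (hs.norm_kernelSum_le hσ hB))
  simpa using this

theorem IsBoundedKernel.summable_integral_norm (hs : IsBoundedKernel s C) (P : Measure X)
    [IsProbabilityMeasure P] :
    Summable (fun n => ∫ x, ‖s n x‖ ∂P) ∧ ∑' n, ∫ x, ‖s n x‖ ∂P ≤ C := by
  have hb : ∀ u : Finset I, ∑ n ∈ u, ∫ x, ‖s n x‖ ∂P ≤ C := by
    intro u
    rw [← integral_finsetSum _ fun n _ => (hs.integrable P n).norm]
    refine (integral_mono (integrable_finsetSum _ fun n _ => (hs.integrable P n).norm)
      (integrable_const C) fun x => ?_).trans (by simp)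
    exact ((hs.summable x).sum_le_tsum u fun _ _ => norm_nonneg _).trans (hs.tsum_le x)
  have h0 : ∀ n, 0 ≤ ∫ x, ‖s n x‖ ∂P := fun n => integral_nonneg fun x => norm_nonneg _
  have hsm := summable_of_sum_le h0 hb
  exact ⟨hsm, hsm.tsum_le_of_sum_le hb⟩

theorem IsBoundedKernel.integral_kernelSum [Countable I] (hs : IsBoundedKernel s C)
    (hσ : ∀ n, ‖σ n‖ ≤ B)
    (P : Measure X) [IsProbabilityMeasure P] :
    ∫ x, kernelSum s σ x ∂P = ∑' n, (∫ x, s n x ∂P) * σ n := by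
  have h := hasSum_integral_of_summable_integral_norm (μ := P) (F := fun n x => s n x * σ n)
    (fun n => (hs.integrable P n).mul_const _) ?_
  · simp_rw [integral_mul_const] at h
    exact h.tsum_eq.symm
  · refine Summable.of_nonneg_of_le (fun n => integral_nonneg fun x => norm_nonneg _) (fun n => ?_)
      ((hs.summable_integral_norm P).1.mul_right B)
    simp_rw [norm_mul]
    rw [integral_mul_const]
    exact mul_le_mul_of_nonneg_left (hσ n) (integral_nonneg fun x => norm_nonneg _)

end Kernel

/-! ### Convolution kernels -/

/-- The index `⌊y²⌋` of the sequence entry that represents the point `y`. -/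
def sqFloor (y : ℝ) : ℕ := ⌊(max y 0) ^ 2⌋₊

@[fun_prop]
theorem measurable_sqFloor : Measurable sqFloor := by
  unfold sqFloor; exact Nat.measurable_floor.comp (by fun_prop)

/-- Rounding `y ^ 2` down to `s ^ 2` loses less than `1`. Then `(y - s) (y + s) < 1` together with
`y > 1 / δ` forces `y - s < δ`. -/
theorem abs_sqrt_sqFloor_sub_lt {y δ : ℝ} (hδ : 0 < δ) (hy : 1 / δ < y) :
    |√(sqFloor y) - y| < δ := by
  have hy0 : 0 < y := lt_trans (by positivity) hy
  have h1 : (sqFloor y : ℝ) ≤ y ^ 2 := by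
    rw [sqFloor, max_eq_left hy0.le]; exact Nat.floor_le (by positivity)
  have h2 : y ^ 2 < sqFloor y + 1 := by
    rw [sqFloor, max_eq_left hy0.le]; exact Nat.lt_floor_add_one _
  set s := √(sqFloor y : ℝ) with hs
  have hs0 : 0 ≤ s := Real.sqrt_nonneg _
  have hs2 : s ^ 2 = sqFloor y := Real.sq_sqrt (by positivity)
  rw [div_lt_iff₀ hδ] at hy
  have h3 : s ≤ y := by nlinarith
  rw [abs_of_nonpos (by linarith)]
  by_contra! hcon
  nlinarith

/-- The convolution with `h`, as a kernel acting on sequences. -/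
def convKernel (h : ℝ → ℂ) (n : ℕ) (x : ℝ) : ℂ :=
  ∫ y in sqFloor ⁻¹' {n}, h (x - y)

theorem integrable_comp_const_sub {h : ℝ → ℂ} (hi : Integrable h) (x : ℝ) :
    Integrable fun y => h (x - y) := hi.comp_sub_left x

theorem hasSum_convKernel {h : ℝ → ℂ} (hi : Integrable h) {σ : ℕ → ℂ} {B : ℝ}
    (hσ : ∀ n, ‖σ n‖ ≤ B) (x : ℝ) :
    HasSum (fun n => convKernel h n x * σ n) (∫ y, h (x - y) * σ (sqFloor y)) := by
  have hI : Integrable fun y => h (x - y) * σ (sqFloor y) :=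
    (integrable_comp_const_sub hi x).mul_bdd (c := B)
      (Measurable.of_discrete (f := σ) |>.comp measurable_sqFloor).aestronglyMeasurable
      (.of_forall fun y => hσ _)
  have hu : ⋃ n, sqFloor ⁻¹' {n} = Set.univ := by ext; simp
  have := hasSum_integral_iUnion (μ := volume) (f := fun y => h (x - y) * σ (sqFloor y))
    (s := fun n => sqFloor ⁻¹' {n})
    (fun n => measurable_sqFloor (measurableSet_singleton n))
    (fun i j hij => Disjoint.preimage _ (by simpa using hij)) hI.integrableOn
  rw [hu, setIntegral_univ] at this
  have e : ∀ n, ∫ y in sqFloor ⁻¹' {n}, h (x - y) * σ (sqFloor y) =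
      convKernel h n x * σ n := by
    intro n
    rw [convKernel, ← integral_mul_const]
    refine setIntegral_congr_fun (measurable_sqFloor (measurableSet_singleton n)) fun y hy => ?_
    rw [show sqFloor y = n from hy]
  simpa only [e] using this

theorem isBoundedKernel_convKernel {h : ℝ → ℂ} (hc : Continuous h) (hi : Integrable h) :
    IsBoundedKernel (convKernel h) (∫ y, ‖h y‖) := by
  have hm : ∀ n, MeasurableSet (sqFloor ⁻¹' {n}) := fun n =>
    measurable_sqFloor (measurableSet_singleton n)
  have hu : ⋃ n, sqFloor ⁻¹' {n} = Set.univ := by ext; simp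
  have hsum : ∀ x, HasSum (fun n => ∫ y in sqFloor ⁻¹' {n}, ‖h (x - y)‖) (∫ y, ‖h y‖) := by
    intro x
    have := hasSum_integral_iUnion (μ := volume) (f := fun y => ‖h (x - y)‖)
      (s := fun n => sqFloor ⁻¹' {n}) hm
      (fun i j hij => Disjoint.preimage _ (by simpa using hij))
      (integrable_comp_const_sub hi x).norm.integrableOn
    rwa [hu, setIntegral_univ, integral_sub_left_eq_self (fun y => ‖h y‖)] at this
  have hle : ∀ n x, ‖convKernel h n x‖ ≤ ∫ y in sqFloor ⁻¹' {n}, ‖h (x - y)‖ := fun n x =>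
    norm_integral_le_integral_norm _
  have hs : ∀ x, Summable fun n => ‖convKernel h n x‖ := fun x =>
    Summable.of_nonneg_of_le (fun n => norm_nonneg _) (fun n => hle n x) (hsum x).summable
  refine ⟨fun n => ?_, hs, fun x => ?_⟩
  · have : StronglyMeasurable (Function.uncurry fun x y : ℝ => h (x - y)) :=
      (hc.comp (by fun_prop : Continuous fun p : ℝ × ℝ => p.1 - p.2)).stronglyMeasurable
    exact (this.integral_prod_right (ν := volume.restrict (sqFloor ⁻¹' {n}))).measurable
  · rw [← (hsum x).tsum_eq]
    exact (hs x).tsum_le_tsum (fun n => hle n x) (hsum x).summable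

theorem exists_tail_le {Φ : ℝ → ℂ} (hΦ : Integrable Φ) {ε : ℝ} (hε : 0 < ε) :
    ∃ A : ℝ, 0 < A ∧ ∫ v, {v | A < |v|}.indicator (fun v => ‖Φ v‖) v ≤ ε := by
  have h : Tendsto (fun n : ℕ => ∫ v, {v | (n : ℝ) < |v|}.indicator (fun v => ‖Φ v‖) v) atTop
      (𝓝 (∫ _v : ℝ, (0 : ℝ))) := by
    refine tendsto_integral_of_dominated_convergence (fun v => ‖Φ v‖) (fun n => ?_) hΦ.norm
      (fun n => .of_forall fun v => ?_) (.of_forall fun v => ?_)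
    · exact hΦ.norm.aestronglyMeasurable.indicator
        (measurableSet_lt measurable_const (by fun_prop))
    · rw [Real.norm_of_nonneg (Set.indicator_nonneg (fun _ _ => norm_nonneg _) _)]
      exact Set.indicator_le_self' (fun _ _ => norm_nonneg _) _
    · refine tendsto_const_nhds.congr' ?_
      filter_upwards [tendsto_natCast_atTop_atTop.eventually_ge_atTop |v|] with n hn
      rw [Set.indicator_of_notMem]
      simpa using hn
  rw [integral_zero] at h
  obtain ⟨n, hn, hn0⟩ := ((h.eventually_le_const hε).and (eventually_gt_atTop 0)).exists
  exact ⟨n, by exact_mod_cast hn0, hn⟩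

/-- Fubini moves the Gaussian average onto `h`, where the deconvolution identity applies, and `v = R
y` rescales. The result averages the step function around `c` at scale `1 / R`. -/
theorem integral_limitDensity_convKernel {h Φ : ℝ → ℂ} {R : ℝ} (hR : 0 < R) (hc : Continuous h)
    (hi : Integrable h)
    (hΦ : ∀ v, ∫ u, (limitDensity u : ℂ) * h (v + u) = R * Φ (R * v))
    {σ : ℕ → ℂ} {B : ℝ} (hσ : ∀ n, ‖σ n‖ ≤ B) (c : ℝ) :
    ∫ u, (limitDensity u : ℂ) * kernelSum (convKernel h) σ (c + u) =
      ∫ v, Φ v * σ (sqFloor (c - v / R)) := by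
  have hg := integrable_limitDensity.ofReal (𝕜 := ℂ)
  have hσm : Measurable fun y => σ (sqFloor y) :=
    Measurable.of_discrete (f := σ) |>.comp measurable_sqFloor
  have hint1 : Integrable (Function.uncurry fun u y : ℝ => (limitDensity u : ℂ) * h (c + u - y))
      (volume.prod volume) := by
    have hm : AEStronglyMeasurable
        (Function.uncurry fun u y : ℝ => (limitDensity u : ℂ) * h (c + u - y))
        (volume.prod volume) := by
      refine Continuous.aestronglyMeasurable ?_
      simp only [Function.uncurry_def]
      fun_prop
    rw [integrable_prod_iff hm]
    refine ⟨.of_forall fun u => ?_, ?_⟩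
    · exact (integrable_comp_const_sub hi (c + u)).const_mul (limitDensity u : ℂ)
    · simp only [Function.uncurry_def, norm_mul]
      have : ∀ u : ℝ, ∫ y, ‖(limitDensity u : ℂ)‖ * ‖h (c + u - y)‖ =
          ‖(limitDensity u : ℂ)‖ * ∫ y, ‖h y‖ := by
        intro u
        rw [integral_const_mul, integral_sub_left_eq_self (fun y => ‖h y‖)]
      simp_rw [this]
      exact hg.norm.mul_const _
  have hint : Integrable (Function.uncurry fun u y : ℝ =>
      (limitDensity u : ℂ) * h (c + u - y) * σ (sqFloor y)) (volume.prod volume) :=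
    hint1.mul_bdd (c := B) (hσm.comp measurable_snd).aestronglyMeasurable
      (.of_forall fun p => hσ _)
  calc ∫ u, (limitDensity u : ℂ) * kernelSum (convKernel h) σ (c + u)
      = ∫ u, ∫ y, (limitDensity u : ℂ) * h (c + u - y) * σ (sqFloor y) := by
        congr 1; ext u
        rw [kernelSum, (hasSum_convKernel hi hσ _).tsum_eq, ← integral_const_mul]
        simp_rw [mul_assoc]
    _ = ∫ y, ∫ u, (limitDensity u : ℂ) * h (c + u - y) * σ (sqFloor y) :=
        integral_integral_swap hint
    _ = ∫ y, R * Φ (R * (c - y)) * σ (sqFloor y) := by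
        congr 1; ext y
        rw [integral_mul_const, ← hΦ]
        congr 2; ext u; congr 2; ring
    _ = ∫ y, R * Φ (R * y) * σ (sqFloor (c - y)) := by
        rw [← integral_sub_left_eq_self _ _ c]
        simp
    _ = _ := by
        have h := Measure.integral_comp_mul_left (fun v => Φ v * σ (sqFloor (c - v / R))) R
        have e : ∀ y, R * y / R = y := fun y => by field_simp
        simp_rw [e] at h
        rw [abs_of_pos (by positivity), Complex.real_smul] at h
        simp_rw [mul_assoc]
        rw [integral_const_mul, h, ← mul_assoc]
        push_cast
        rw [mul_inv_cancel₀ (by exact_mod_cast hR.ne'), one_mul]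

/-- Sequences with values bounded by `B` and modulus of continuity `δ` for the distance
`|√m - √n|` are recovered, far out, from a bounded kernel that depends on `B`, `δ` only. -/
theorem exists_kernel_eventually {B : ℝ} (hB : 0 ≤ B) {δ : ℝ → ℝ} (hδ : ∀ ε > 0, 0 < δ ε)
    {ε : ℝ} (hε : 0 < ε) :
    ∃ (s : ℕ → ℝ → ℂ) (C : ℝ), IsBoundedKernel s C ∧ ∃ M : ℕ, ∀ σ : ℕ → ℂ, (∀ n, ‖σ n‖ ≤ B) →
      (∀ ε > 0, ∀ m n : ℕ, |√(m : ℝ) - √n| < δ ε → ‖σ m - σ n‖ < ε) →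
      ∀ m ≥ M, ‖∫ w, kernelSum s σ ‖w‖ ∂radialMeasure m - σ m‖ ≤ ε := by
  obtain ⟨Φ, hΦi, hΦ1, hΦ⟩ := exists_gaussian_deconvolution
  set L := ∫ v, ‖Φ v‖ with hL
  have hL0 : 0 ≤ L := integral_nonneg fun v => norm_nonneg _
  -- Error budget: `ε / 4` for replacing the law of the modulus by its Gaussian limit, `ε / 4` for
  -- the oscillation of `σ` where `|v| ≤ A`, and `ε / 4` for the tail of `Φ`.
  set ε₁ := ε / (4 * (L + 1)) with hε₁
  have hε₁0 : 0 < ε₁ := by positivity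
  set δ₁ := δ ε₁ with hδ₁
  have hδ₁0 : 0 < δ₁ := hδ _ hε₁0
  obtain ⟨A, hA0, hA⟩ := exists_tail_le hΦi (ε := ε / (4 * (2 * B + 1))) (by positivity)
  -- For `|v| ≤ A` this makes `|v / R| ≤ δ₁ / 2`; the other half of `δ₁` is left for the rounding in
  -- `sqFloor`.
  set R := 2 * A / δ₁ with hR
  have hR0 : 0 < R := by positivity
  obtain ⟨h, hc, hi, hh⟩ := hΦ R hR0
  set H := ∫ y, ‖h y‖ with hH
  have hH0 : 0 ≤ H := integral_nonneg fun v => norm_nonneg _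
  have hker := isBoundedKernel_convKernel hc hi
  have ev1 := tendsto_integral_abs_modulusDensity_sub.eventually_le_const
    (show (0 : ℝ) < ε / (4 * (H * B + 1)) by positivity)
  -- Ensures that `√m - v / R` exceeds `1 / (δ₁ / 2)`, as `abs_sqrt_sqFloor_sub_lt` requires.
  have ev2 := (Real.tendsto_sqrt_atTop.comp tendsto_natCast_atTop_atTop).eventually_gt_atTop
    (δ₁ / 2 + 1 / (δ₁ / 2))
  obtain ⟨M, hM⟩ := eventually_atTop.1 (ev1.and ev2)
  refine ⟨convKernel h, H, hker, M, fun σ hσ hσδ m hm => ?_⟩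
  obtain ⟨h1, h2⟩ := hM m hm
  simp only [Function.comp_apply] at h2
  set S := kernelSum (convKernel h) σ with hS
  have hSm : Measurable S := measurable_kernelSum hker.measurable
  have hSb : ∀ x, ‖S x‖ ≤ H * B := hker.norm_kernelSum_le hσ hB
  have hp : Integrable fun u => (modulusDensity m (√m + u) : ℂ) :=
    ((integrable_modulusDensity m).comp_add_left _).ofReal
  have hg := integrable_limitDensity.ofReal (𝕜 := ℂ)
  have hSu : AEStronglyMeasurable (fun u => S (√m + u)) volume :=
    (hSm.comp (measurable_const_add _)).aestronglyMeasurable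
  have hpS : Integrable fun u => (modulusDensity m (√m + u) : ℂ) * S (√m + u) :=
    hp.mul_bdd (c := H * B) hSu (.of_forall fun u => hSb _)
  have hgS : Integrable fun u => (limitDensity u : ℂ) * S (√m + u) :=
    hg.mul_bdd (c := H * B) hSu (.of_forall fun u => hSb _)
  have e1 : ∫ w, S ‖w‖ ∂radialMeasure m = ∫ u, (modulusDensity m (√m + u) : ℂ) * S (√m + u) := by
    rw [integral_comp_norm_radialMeasure]
    simp_rw [Complex.real_smul]
    rw [← integral_add_left_eq_self (μ := volume) _ √(m : ℝ)]
  have b1 : ‖∫ w, S ‖w‖ ∂radialMeasure m - ∫ u, (limitDensity u : ℂ) * S (√m + u)‖ ≤ ε / 4 := by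
    rw [e1, ← integral_sub hpS hgS]
    calc _ ≤ ∫ u, |modulusDensity m (√m + u) - limitDensity u| * (H * B) := by
          refine norm_integral_le_of_norm_le
            (((integrable_modulusDensity m).comp_add_left _).sub
              integrable_limitDensity |>.abs.mul_const _) (.of_forall fun u => ?_)
          rw [← sub_mul, norm_mul, ← Complex.ofReal_sub, Complex.norm_real, Real.norm_eq_abs]
          exact mul_le_mul_of_nonneg_left (hSb _) (abs_nonneg _)
      _ ≤ ε / (4 * (H * B + 1)) * (H * B) := by
          rw [integral_mul_const]
          gcongr
      _ ≤ ε / 4 := by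
          have : 0 ≤ H * B := by positivity
          rw [div_mul_eq_mul_div, div_le_div_iff₀ (by positivity) (by positivity)]
          nlinarith
  have b2 : ‖(∫ u, (limitDensity u : ℂ) * S (√m + u)) - σ m‖ ≤ ε / 2 := by
    rw [hS, integral_limitDensity_convKernel hR0 hc hi hh hσ]
    have hσm : Measurable fun v => σ (sqFloor (√m - v / R)) :=
      Measurable.of_discrete (f := σ) |>.comp (measurable_sqFloor.comp (by fun_prop))
    have i1 : Integrable fun v => Φ v * σ (sqFloor (√m - v / R)) :=
      hΦi.mul_bdd (c := B) hσm.aestronglyMeasurable (.of_forall fun v => hσ _)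
    have e2 : σ m = ∫ v, Φ v * σ m := by rw [integral_mul_const, hΦ1, one_mul]
    rw [e2, ← integral_sub i1 (hΦi.mul_const _)]
    have hind : Integrable ({v | A < |v|}.indicator (fun v => ‖Φ v‖)) :=
      hΦi.norm.indicator (measurableSet_lt measurable_const (by fun_prop))
    calc _ ≤ ∫ v, (ε₁ * ‖Φ v‖ + 2 * B * {v | A < |v|}.indicator (fun v => ‖Φ v‖) v) := by
          refine norm_integral_le_of_norm_le ((hΦi.norm.const_mul _).add (hind.const_mul _))
            (.of_forall fun v => ?_)
          rw [← mul_sub, norm_mul]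
          by_cases hv : A < |v|
          · rw [Set.indicator_of_mem (show v ∈ {v | A < |v|} from hv)]
            have : ‖σ (sqFloor (√m - v / R)) - σ m‖ ≤ 2 * B := by
              refine (norm_sub_le _ _).trans ?_
              linarith [hσ (sqFloor (√m - v / R)), hσ m]
            nlinarith [norm_nonneg (Φ v), mul_le_mul_of_nonneg_left this (norm_nonneg (Φ v))]
          · rw [Set.indicator_of_notMem (show v ∉ {v | A < |v|} from hv), mul_zero, add_zero,
              mul_comm]
            refine mul_le_mul_of_nonneg_right (hσδ ε₁ hε₁0 _ _ ?_).le (norm_nonneg _)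
            have hvR : |v / R| ≤ δ₁ / 2 := by
              rw [abs_div, abs_of_pos hR0, div_le_iff₀ hR0, hR]
              have : δ₁ / 2 * (2 * A / δ₁) = A := by field_simp
              rw [this]
              exact not_lt.1 hv
            have h3 := abs_sqrt_sqFloor_sub_lt (y := √m - v / R) (half_pos hδ₁0) (by
              linarith [le_abs_self (v / R)])
            calc _ = |(√(sqFloor (√m - v / R)) - (√m - v / R)) + -(v / R)| := by congr 1; ring
              _ ≤ |√(sqFloor (√m - v / R)) - (√m - v / R)| + |-(v / R)| := abs_add_le _ _
              _ < δ₁ := by rw [abs_neg]; linarith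
      _ = ε₁ * L + 2 * B * ∫ v, {v | A < |v|}.indicator (fun v => ‖Φ v‖) v := by
          rw [integral_add (hΦi.norm.const_mul _) (hind.const_mul _), integral_const_mul,
            integral_const_mul]
      _ ≤ ε₁ * L + 2 * B * (ε / (4 * (2 * B + 1))) := by gcongr
      _ ≤ ε / 4 + ε / 4 := by
          gcongr
          · rw [hε₁, div_mul_eq_mul_div, div_le_div_iff₀ (by positivity) (by positivity)]
            nlinarith
          · rw [mul_div_assoc', div_le_div_iff₀ (by positivity) (by positivity)]
            nlinarith
      _ = ε / 2 := by ring
  have b3 := norm_sub_le_norm_sub_add_norm_sub (∫ w, S ‖w‖ ∂radialMeasure m)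
    (∫ u, (limitDensity u : ℂ) * S (√m + u)) (σ m)
  linarith

/-! ### Recovering finitely many entries -/

/-- Changing the weight to `exp (-‖w‖ ^ 2 / z)` multiplies the Gaussian moment by `z ^ (m + 1)`. For
`z ≤ 1` the integrand is bounded, so geometric sequences are available for isolating single entries.
-/
theorem integral_exp_radialMeasure {z : ℝ} (hz : 0 < z) (m : ℕ) :
    ∫ w, ((z⁻¹ * Real.exp (-(z⁻¹ - 1) * ‖w‖ ^ 2) : ℝ) : ℂ) ∂radialMeasure m = (z : ℂ) ^ m := by
  rw [integral_complex_ofReal, ← Complex.ofReal_pow]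
  congr 1
  rw [integral_radialMeasure]
  have h := Complex.integral_rpow_mul_exp_neg_mul_rpow (p := 2) (q := (2 * m : ℕ)) (b := z⁻¹)
    (by norm_num) (by linarith [(2 * m : ℕ).cast_nonneg (α := ℝ)]) (by positivity)
  have e : ((2 * m : ℕ) + 2 : ℝ) / 2 = (m + 1 : ℕ) := by push_cast; ring
  rw [neg_div, e, Real.rpow_neg (by positivity), Real.rpow_natCast] at h
  rw [Nat.cast_succ, Real.Gamma_nat_eq_factorial] at h
  have e2 : ∀ w : ℂ, ((Real.pi * m.factorial)⁻¹ * (‖w‖ ^ (2 * m) * Real.exp (-‖w‖ ^ 2))) •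
      (z⁻¹ * Real.exp (-(z⁻¹ - 1) * ‖w‖ ^ 2)) = (Real.pi * m.factorial)⁻¹ * z⁻¹ *
      (‖w‖ ^ ((2 * m : ℕ) : ℝ) * Real.exp (-z⁻¹ * ‖w‖ ^ (2 : ℝ))) := by
    intro w
    have : Real.exp (-z⁻¹ * ‖w‖ ^ 2) =
        Real.exp (-‖w‖ ^ 2) * Real.exp (-(z⁻¹ - 1) * ‖w‖ ^ 2) := by
      rw [← Real.exp_add]; congr 1; ring
    rw [Real.rpow_natCast, Real.rpow_two, this, smul_eq_mul]
    ring
  simp_rw [e2]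
  rw [integral_const_mul, h]
  have := Real.pi_ne_zero
  simp only [inv_pow, inv_inv]
  rw [pow_succ]
  field_simp

/-- The coordinate functionals of the sequence space are uniform limits of moment sequences
`m ↦ ∫ d |w| dμₘ` with `d` bounded. -/
theorem exists_approx_single (j : ℕ) {η : ℝ} (hη : 0 < η) :
    ∃ (d : ℝ → ℂ) (D : ℝ), Measurable d ∧ (∀ x, ‖d x‖ ≤ D) ∧
      ∀ m, ‖∫ w, d ‖w‖ ∂radialMeasure m - if m = j then 1 else 0‖ ≤ η := by
  induction j using Nat.strong_induction_on generalizing η with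
  | _ j ih =>
  -- The sequence `z ^ m / z ^ j`, once its entries before `j` are removed, equals `1` at `j` and is
  -- at most `z ≤ η / 2` beyond `j`. The removal uses the approximations given by strong induction.
  set z : ℝ := min (η / 2) 1 with hz
  have hz0 : 0 < z := by positivity
  have hz1 : z ≤ 1 := min_le_right _ _
  have hzη : z ≤ η / 2 := min_le_left _ _
  -- Up to `j` inductive errors are summed and then magnified by `(z ^ j)⁻¹`; this accuracy keeps
  -- the total below `η / 2`.
  have hη' : 0 < z ^ j * η / (2 * (j + 1)) := by positivity
  choose! d D hdm hdD hd using fun i (hi : i < j) => ih i hi hη'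
  have hdint : ∀ i < j, ∀ m, Integrable (fun w : ℂ => d i ‖w‖) (radialMeasure m) := fun i hi m =>
    Integrable.of_bound ((hdm i hi).comp measurable_norm).aestronglyMeasurable (D i)
      (.of_forall fun w => hdD i hi _)
  set ψ : ℝ → ℂ := fun x => ((z⁻¹ * Real.exp (-(z⁻¹ - 1) * x ^ 2) : ℝ) : ℂ) with hψ
  have hψm : Measurable ψ := by simp only [hψ]; fun_prop
  have hψb : ∀ x, ‖ψ x‖ ≤ z⁻¹ := by
    intro x
    simp only [hψ]
    rw [Complex.norm_real, Real.norm_of_nonneg (by positivity)]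
    refine mul_le_of_le_one_right (by positivity) (Real.exp_le_one_iff.2 ?_)
    have : 1 ≤ z⁻¹ := (one_le_inv₀ hz0).2 hz1
    nlinarith [sq_nonneg x]
  have hψint : ∀ m, Integrable (fun w : ℂ => ψ ‖w‖) (radialMeasure m) := fun m =>
    Integrable.of_bound (hψm.comp measurable_norm).aestronglyMeasurable z⁻¹
      (.of_forall fun w => hψb _)
  refine ⟨fun x => ((z : ℂ) ^ j)⁻¹ * (ψ x - ∑ i ∈ Finset.range j, (z : ℂ) ^ i * d i x),
    (z ^ j)⁻¹ * (z⁻¹ + ∑ i ∈ Finset.range j, z ^ i * D i), ?_, ?_, ?_⟩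
  · refine (hψm.sub (Finset.measurable_fun_sum _ fun i hi => ?_)).const_mul _
    exact (hdm i (Finset.mem_range.1 hi)).const_mul _
  · intro x
    rw [norm_mul, norm_inv, norm_pow, Complex.norm_real, Real.norm_of_nonneg hz0.le]
    gcongr
    refine (norm_sub_le _ _).trans (add_le_add (hψb x) ((norm_sum_le _ _).trans ?_))
    refine Finset.sum_le_sum fun i hi => ?_
    rw [norm_mul, norm_pow, Complex.norm_real, Real.norm_of_nonneg hz0.le]
    gcongr
    exact hdD i (Finset.mem_range.1 hi) x
  · intro m
    have hsi : Integrable (fun w : ℂ => ∑ i ∈ Finset.range j, (z : ℂ) ^ i * d i ‖w‖)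
        (radialMeasure m) :=
      integrable_finsetSum _ fun i hi => (hdint i (Finset.mem_range.1 hi) m).const_mul _
    have hzc : ((z : ℂ) ^ j) ≠ 0 := by simp [hz0.ne']
    rw [integral_const_mul, integral_sub (hψint m) hsi, integral_exp_radialMeasure hz0,
      integral_finsetSum _ fun i hi => (hdint i (Finset.mem_range.1 hi) m).const_mul _]
    simp_rw [integral_const_mul]
    set T : ℕ → ℂ := fun i => ∫ w, d i ‖w‖ ∂radialMeasure m with hT
    have key : ((z : ℂ) ^ j)⁻¹ * ((z : ℂ) ^ m - ∑ i ∈ Finset.range j, (z : ℂ) ^ i * T i) -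
        (if m = j then 1 else 0) = ((z : ℂ) ^ j)⁻¹ * (if j < m then (z : ℂ) ^ m else 0) -
        ((z : ℂ) ^ j)⁻¹ * ∑ i ∈ Finset.range j, (z : ℂ) ^ i * (T i - if m = i then 1 else 0) := by
      simp_rw [mul_sub, Finset.sum_sub_distrib, mul_ite, mul_one, mul_zero,
        Finset.sum_ite_eq, Finset.mem_range]
      rcases lt_trichotomy m j with hmj | hmj | hmj
      · simp [hmj, hmj.ne, hmj.not_gt]
        ring
      · subst hmj
        simp
        field_simp
        ring
      · simp [hmj, hmj.ne', hmj.not_gt]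
    rw [key]
    have b1 : ‖((z : ℂ) ^ j)⁻¹ * (if j < m then (z : ℂ) ^ m else 0)‖ ≤ η / 2 := by
      split_ifs with hmj
      · obtain ⟨c, rfl⟩ := Nat.exists_eq_add_of_lt hmj
        rw [add_assoc, pow_add, inv_mul_cancel_left₀ hzc, norm_pow, Complex.norm_real,
          Real.norm_of_nonneg hz0.le]
        exact (pow_le_of_le_one hz0.le hz1 (by omega)).trans hzη
      · simp only [mul_zero, norm_zero]
        positivity
    have b2 : ‖((z : ℂ) ^ j)⁻¹ *
        ∑ i ∈ Finset.range j, (z : ℂ) ^ i * (T i - if m = i then 1 else 0)‖ ≤ η / 2 := by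
      rw [norm_mul, norm_inv, norm_pow, Complex.norm_real, Real.norm_of_nonneg hz0.le]
      have : ‖∑ i ∈ Finset.range j, (z : ℂ) ^ i * (T i - if m = i then 1 else 0)‖ ≤
          ∑ _i ∈ Finset.range j, z ^ j * η / (2 * (j + 1)) := by
        refine (norm_sum_le _ _).trans (Finset.sum_le_sum fun i hi => ?_)
        rw [norm_mul, norm_pow, Complex.norm_real, Real.norm_of_nonneg hz0.le]
        exact (mul_le_of_le_one_left (norm_nonneg _) (pow_le_one₀ hz0.le hz1)).trans
          (hd i (Finset.mem_range.1 hi) m)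
      rw [Finset.sum_const, Finset.card_range, nsmul_eq_mul] at this
      calc _ ≤ (z ^ j)⁻¹ * (j * (z ^ j * η / (2 * (j + 1)))) := by gcongr
        _ = η / 2 * (j / (j + 1)) := by field_simp
        _ ≤ η / 2 * 1 := by
          gcongr
          rw [div_le_one (by positivity)]; linarith
        _ = η / 2 := mul_one _
    refine (norm_sub_le _ _).trans ?_
    linarith

/-! ### Operations on bounded kernels -/

theorem IsBoundedKernel.comp {I X Y : Type*} [MeasurableSpace X] [MeasurableSpace Y]
    {s : I → X → ℂ} {C : ℝ} (hs : IsBoundedKernel s C) {f : Y → X} (hf : Measurable f) :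
    IsBoundedKernel (fun n y => s n (f y)) C :=
  ⟨fun n => (hs.measurable n).comp hf, fun y => hs.summable (f y), fun y => hs.tsum_le (f y)⟩

theorem IsBoundedKernel.add {I X : Type*} [MeasurableSpace X] {s t : I → X → ℂ} {C D : ℝ}
    (hs : IsBoundedKernel s C) (ht : IsBoundedKernel t D) :
    IsBoundedKernel (fun n x => s n x + t n x) (C + D) := by
  have h : ∀ x, Summable fun n => ‖s n x + t n x‖ := fun x =>
    Summable.of_nonneg_of_le (fun n => norm_nonneg _) (fun n => norm_add_le _ _)
      ((hs.summable x).add (ht.summable x))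
  refine ⟨fun n => (hs.measurable n).add (ht.measurable n), h, fun x => ?_⟩
  refine ((h x).tsum_le_tsum (fun n => norm_add_le _ _)
    ((hs.summable x).add (ht.summable x))).trans ?_
  rw [(hs.summable x).tsum_add (ht.summable x)]
  exact add_le_add (hs.tsum_le x) (ht.tsum_le x)

theorem isBoundedKernel_zero {I X : Type*} [MeasurableSpace X] :
    IsBoundedKernel (fun (_ : I) (_ : X) => 0) 0 :=
  ⟨fun _ => measurable_const, fun _ => by simp, fun _ => by simp⟩

theorem IsBoundedKernel.sum {J I X : Type*} [MeasurableSpace X] {s : J → I → X → ℂ} {C : J → ℝ}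
    {u : Finset J} (hs : ∀ j ∈ u, IsBoundedKernel (s j) (C j)) :
    IsBoundedKernel (fun n x => ∑ j ∈ u, s j n x) (∑ j ∈ u, C j) := by
  classical
  induction u using Finset.induction_on with
  | empty => simpa using isBoundedKernel_zero
  | insert j u hj ih =>
    simp_rw [Finset.sum_insert hj]
    exact (hs j (Finset.mem_insert_self _ _)).add
      (ih fun i hi => hs i (Finset.mem_insert_of_mem hi))

theorem isBoundedKernel_mul {I X : Type*} [MeasurableSpace X] {a : I → ℂ} {d : X → ℂ} {A D : ℝ}
    (ha : Summable fun n => ‖a n‖) (hA : ∑' n, ‖a n‖ ≤ A) (hd : Measurable d)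
    (hD : ∀ x, ‖d x‖ ≤ D) :
    IsBoundedKernel (fun n x => d x * a n) (D * A) := by
  refine ⟨fun n => hd.mul_const _, fun x => ?_, fun x => ?_⟩
  · simp_rw [norm_mul]; exact ha.mul_left _
  · simp_rw [norm_mul]
    rw [tsum_mul_left]
    exact mul_le_mul (hD x) hA (tsum_nonneg fun n => norm_nonneg _)
      ((norm_nonneg _).trans (hD x))

/-! ### Uniform recovery in one variable -/

/-- Sequences with values bounded by `B` and modulus of continuity `δ` for the distance
`|√m - √n|` are recovered uniformly from a bounded kernel that depends on `B`, `δ` only. -/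
theorem exists_kernel {B : ℝ} (hB : 0 ≤ B) {δ : ℝ → ℝ} (hδ : ∀ ε > 0, 0 < δ ε)
    {ε : ℝ} (hε : 0 < ε) :
    ∃ (s : ℕ → ℝ → ℂ) (C : ℝ), IsBoundedKernel s C ∧ ∀ σ : ℕ → ℂ, (∀ n, ‖σ n‖ ≤ B) →
      (∀ ε > 0, ∀ m n : ℕ, |√(m : ℝ) - √n| < δ ε → ‖σ m - σ n‖ < ε) →
      ∀ m, ‖∫ w, kernelSum s σ ‖w‖ ∂radialMeasure m - σ m‖ ≤ ε := by
  obtain ⟨s, C, hs, M, hM⟩ := exists_kernel_eventually hB hδ (half_pos hε)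
  have hC : 0 ≤ C := (norm_nonneg _).trans (hs.norm_le 0 0)
  -- Each of the `M` corrections has coefficient at most `B + C * B`, so errors `η` in the
  -- coordinate symbols cost at most `ε / 2` in total.
  set η := ε / (2 * (M * (B + C * B) + 1)) with hη
  have hη0 : 0 < η := by positivity
  choose d D hdm hdD hd using fun j => exists_approx_single j hη0
  have hsn : IsBoundedKernel (fun n (w : ℂ) => s n ‖w‖) C := hs.comp measurable_norm
  -- The row `a j` represents the linear functional `σ ↦ σ j - T j`, the defect at `j` of the
  -- uncorrected kernel. The correction `∑ d j * (σ j - T j)` is therefore again given by a kernel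
  -- independent of `σ`.
  set a : ℕ → ℕ → ℂ := fun j n => (if n = j then 1 else 0) - ∫ w, s n ‖w‖ ∂radialMeasure j with ha
  have h1 : ∀ j, Summable fun n : ℕ => ‖(if n = j then 1 else 0 : ℂ)‖ := fun j =>
    summable_of_ne_finset_zero (s := {j}) fun n hn => by simp_all
  have h1t : ∀ j, ∑' n : ℕ, ‖(if n = j then 1 else 0 : ℂ)‖ = 1 := fun j => by
    rw [tsum_eq_single j fun n hn => by simp [hn]]; simp
  have h2 : ∀ j, Summable fun n => ‖∫ w, s n ‖w‖ ∂radialMeasure j‖ := fun j =>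
    Summable.of_nonneg_of_le (fun n => norm_nonneg _) (fun n => norm_integral_le_integral_norm _)
      (hsn.summable_integral_norm (radialMeasure j)).1
  have h2t : ∀ j, ∑' n, ‖∫ w, s n ‖w‖ ∂radialMeasure j‖ ≤ C := fun j =>
    ((h2 j).tsum_le_tsum (fun n => norm_integral_le_integral_norm _)
      (hsn.summable_integral_norm (radialMeasure j)).1).trans
      (hsn.summable_integral_norm (radialMeasure j)).2
  have has : ∀ j, Summable fun n => ‖a j n‖ := fun j =>
    Summable.of_nonneg_of_le (fun n => norm_nonneg _) (fun n => norm_sub_le _ _)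
      ((h1 j).add (h2 j))
  have hat : ∀ j, ∑' n, ‖a j n‖ ≤ 1 + C := fun j => by
    refine ((has j).tsum_le_tsum (fun n => norm_sub_le _ _) ((h1 j).add (h2 j))).trans ?_
    rw [(h1 j).tsum_add (h2 j), h1t]
    linarith [h2t j]
  have hker := hs.add (IsBoundedKernel.sum (u := Finset.range M) fun j _ =>
    isBoundedKernel_mul (has j) (hat j) (hdm j) (hdD j))
  refine ⟨_, _, hker, fun σ hσ hσδ m => ?_⟩
  set T : ℕ → ℂ := fun j => ∫ w, kernelSum s σ ‖w‖ ∂radialMeasure j with hT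
  have hTb : ∀ j, ‖σ j - T j‖ ≤ B + C * B := fun j => by
    refine (norm_sub_le _ _).trans (add_le_add (hσ j) ?_)
    exact hsn.norm_integral_kernelSum_le hσ hB (radialMeasure j)
  have hasum : ∀ j, ∑' n, a j n * σ n = σ j - T j := fun j => by
    have hT' : T j = ∑' n, (∫ w, s n ‖w‖ ∂radialMeasure j) * σ n :=
      hsn.integral_kernelSum hσ (radialMeasure j)
    simp_rw [ha, sub_mul]
    rw [(summable_mul_of_bounded (h1 j) hσ).of_norm.tsum_sub
      (summable_mul_of_bounded (h2 j) hσ).of_norm, ← hT',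
      tsum_eq_single j fun n hn => by simp [hn]]
    simp
  have hsplit : ∀ x, kernelSum (fun n x => s n x + ∑ j ∈ Finset.range M, d j x * a j n) σ x =
      kernelSum s σ x + ∑ j ∈ Finset.range M, d j x * (σ j - T j) := fun x => by
    have hsj : ∀ j, Summable fun n => d j x * (a j n * σ n) := fun j =>
      (summable_mul_of_bounded (has j) hσ).of_norm.mul_left _
    simp_rw [kernelSum, add_mul, Finset.sum_mul, mul_assoc]
    rw [(summable_mul_of_bounded (hs.summable x) hσ).of_norm.tsum_add
      (summable_sum fun j _ => hsj j), Summable.tsum_finsetSum fun j _ => hsj j]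
    simp_rw [tsum_mul_left, hasum]
  have hdi : ∀ j, Integrable (fun w : ℂ => d j ‖w‖) (radialMeasure m) := fun j =>
    Integrable.of_bound ((hdm j).comp measurable_norm).aestronglyMeasurable (D j)
      (.of_forall fun w => hdD j _)
  simp_rw [hsplit]
  have hSi : Integrable (fun w : ℂ => kernelSum s σ ‖w‖) (radialMeasure m) :=
    hsn.integrable_kernelSum hσ hB (radialMeasure m)
  rw [integral_add hSi
    (integrable_finsetSum _ fun j _ => (hdi j).mul_const _),
    integral_finsetSum _ fun j _ => (hdi j).mul_const _]
  simp_rw [integral_mul_const]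
  -- With exact coordinate symbols the correction would cancel the defect for `m < M` and vanish for
  -- `m ≥ M`; the last sum collects their errors.
  have key : T m + ∑ j ∈ Finset.range M, (∫ w, d j ‖w‖ ∂radialMeasure m) * (σ j - T j) - σ m =
      (if m < M then 0 else T m - σ m) + ∑ j ∈ Finset.range M,
        ((∫ w, d j ‖w‖ ∂radialMeasure m) - if m = j then 1 else 0) * (σ j - T j) := by
    simp_rw [sub_mul _ _ (σ _ - T _), Finset.sum_sub_distrib, ite_mul, one_mul, zero_mul,
      Finset.sum_ite_eq, Finset.mem_range]
    split_ifs <;> ring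
  have hkey := congrArg norm key
  refine (le_of_eq hkey).trans ((norm_add_le _ _).trans ?_)
  have b1 : ‖if m < M then 0 else T m - σ m‖ ≤ ε / 2 := by
    split_ifs with h
    · rw [norm_zero]; positivity
    · exact hM σ hσ hσδ m (not_lt.1 h)
  have b2 : ‖∑ j ∈ Finset.range M,
      ((∫ w, d j ‖w‖ ∂radialMeasure m) - if m = j then 1 else 0) * (σ j - T j)‖ ≤ ε / 2 := by
    refine (norm_sum_le _ _).trans ?_
    calc _ ≤ ∑ _j ∈ Finset.range M, η * (B + C * B) := by
          refine Finset.sum_le_sum fun j _ => ?_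
          rw [norm_mul]
          exact mul_le_mul (hd j m) (hTb j) (norm_nonneg _) hη0.le
      _ = η * (M * (B + C * B)) := by
          rw [Finset.sum_const, Finset.card_range, nsmul_eq_mul]; ring
      _ ≤ ε / 2 := by
          have : 0 ≤ M * (B + C * B) := by positivity
          rw [hη, div_mul_eq_mul_div, div_le_div_iff₀ (by positivity) (by positivity)]
          nlinarith
  linarith

/-! ### Several variables -/

theorem sqrtDist_cons_left {k : ℕ} (a b : ℕ) (n : Fin k → ℕ) :
    sqrtDist (Fin.cons a n : Fin (k + 1) → ℕ) (Fin.cons b n) = |√(a : ℝ) - √(b : ℝ)| := by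
  simp [sqrtDist, Fin.sum_univ_succ]

theorem sqrtDist_cons_right {k : ℕ} (a : ℕ) (m n : Fin k → ℕ) :
    sqrtDist (Fin.cons a m : Fin (k + 1) → ℕ) (Fin.cons a n) = sqrtDist m n := by
  simp [sqrtDist, Fin.sum_univ_succ]

/-- The tensor product of a kernel in the first variable and a kernel in the others. -/
def consKernel {k : ℕ} (s : ℕ → ℝ → ℂ) (t : (Fin k → ℕ) → (Fin k → ℝ) → ℂ)
    (n : Fin (k + 1) → ℕ) (x : Fin (k + 1) → ℝ) : ℂ :=
  s (n 0) (x 0) * t (Fin.tail n) (Fin.tail x)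

theorem summable_norm_mul_prod {I J : Type*} {a : I → ℂ} {b : J → ℂ}
    (ha : Summable fun i => ‖a i‖) (hb : Summable fun j => ‖b j‖) :
    Summable fun p : I × J => ‖a p.1 * b p.2‖ := by
  simp_rw [norm_mul]
  exact ha.mul_of_nonneg hb (fun _ => norm_nonneg _) (fun _ => norm_nonneg _)

theorem isBoundedKernel_consKernel {k : ℕ} {s : ℕ → ℝ → ℂ}
    {t : (Fin k → ℕ) → (Fin k → ℝ) → ℂ} {C D : ℝ} (hs : IsBoundedKernel s C)
    (ht : IsBoundedKernel t D) : IsBoundedKernel (consKernel s t) (C * D) := by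
  have e : ∀ x (p : ℕ × (Fin k → ℕ)), ‖consKernel s t (Fin.consEquiv (fun _ => ℕ) p) x‖ =
      ‖s p.1 (x 0) * t p.2 (Fin.tail x)‖ := fun x p => by simp [consKernel, Fin.consEquiv]
  have hsum : ∀ x : Fin (k + 1) → ℝ, Summable fun p : ℕ × (Fin k → ℕ) =>
      ‖s p.1 (x 0) * t p.2 (Fin.tail x)‖ := fun x =>
    summable_norm_mul_prod (a := fun i => s i (x 0)) (b := fun n => t n (Fin.tail x))
      (hs.summable _) (ht.summable _)
  refine ⟨fun n => ?_, fun x => ?_, fun x => ?_⟩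
  · have h1 : Measurable fun x : Fin (k + 1) → ℝ => Fin.tail x :=
      measurable_pi_lambda _ fun i => measurable_pi_apply _
    exact ((hs.measurable _).comp (measurable_pi_apply 0)).mul ((ht.measurable _).comp h1)
  · exact (Fin.consEquiv fun _ : Fin (k + 1) => ℕ).summable_iff.1
      ((hsum x).congr fun p => (e x p).symm)
  · have h1 := (Fin.consEquiv fun _ : Fin (k + 1) => ℕ).tsum_eq fun n => ‖consKernel s t n x‖
    rw [← h1, tsum_congr (e x)]
    have h2 := hsum x
    simp_rw [norm_mul] at h2 ⊢
    rw [← (hs.summable (x 0)).tsum_mul_tsum (ht.summable (Fin.tail x)) h2]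
    exact mul_le_mul (hs.tsum_le _) (ht.tsum_le _) (tsum_nonneg fun n => norm_nonneg _)
      ((norm_nonneg _).trans (hs.norm_le 0 (x 0)))

/-- Summing over the tail of the index first shows the tensor kernel acting slice by slice, which
lets the last `k` variables be integrated out before the first. -/
theorem kernelSum_consKernel {k : ℕ} {s : ℕ → ℝ → ℂ} {t : (Fin k → ℕ) → (Fin k → ℝ) → ℂ}
    {C D B : ℝ} (hs : IsBoundedKernel s C) (ht : IsBoundedKernel t D)
    {σ : (Fin (k + 1) → ℕ) → ℂ} (hσ : ∀ n, ‖σ n‖ ≤ B) (x : ℝ) (y : Fin k → ℝ) :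
    kernelSum (consKernel s t) σ (Fin.cons x y) =
      ∑' a, s a x * kernelSum t (fun n => σ (Fin.cons a n)) y := by
  have hsum : Summable fun p : ℕ × (Fin k → ℕ) =>
      s p.1 x * t p.2 y * σ (Fin.cons p.1 p.2) :=
    (summable_mul_of_bounded (summable_norm_mul_prod (a := fun i => s i x)
      (b := fun n => t n y) (hs.summable x) (ht.summable y))
      fun p : ℕ × (Fin k → ℕ) => hσ (Fin.cons p.1 p.2)).of_norm
  rw [kernelSum, ← (Fin.consEquiv fun _ => ℕ).tsum_eq]
  have e : ∀ p : ℕ × (Fin k → ℕ), consKernel s t (Fin.consEquiv (fun _ => ℕ) p) (Fin.cons x y) *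
      σ (Fin.consEquiv (fun _ => ℕ) p) = s p.1 x * t p.2 y * σ (Fin.cons p.1 p.2) := by
    intro p
    simp [consKernel, Fin.consEquiv]
  simp_rw [e]
  rw [hsum.tsum_prod]
  simp_rw [mul_assoc, tsum_mul_left]
  rfl

theorem integral_pi_radialMeasure_succ {k : ℕ} (m : Fin (k + 1) → ℕ)
    {f : (Fin (k + 1) → ℂ) → ℂ}
    (hf : Integrable f (Measure.pi fun i => radialMeasure (m i))) :
    ∫ w, f w ∂Measure.pi (fun i => radialMeasure (m i)) =
      ∫ w₀, ∫ w, f (Fin.cons w₀ w) ∂Measure.pi (fun i => radialMeasure (m (Fin.succ i)))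
        ∂radialMeasure (m 0) := by
  have h := (measurePreserving_piFinSuccAbove (fun i => radialMeasure (m i)) 0).symm
  have h2 := h.integral_comp (MeasurableEquiv.measurableEmbedding _) f
  rw [← h2, integral_prod]
  · simp [MeasurableEquiv.piFinSuccAbove, Fin.insertNthEquiv]
  · exact (h.integrable_comp_emb (MeasurableEquiv.measurableEmbedding _)).2 hf

/-- Functions on `ℕ₀ᵏ` with values bounded by `B` and modulus of continuity `δ` for the
square-root metric are recovered uniformly from a bounded kernel that depends on `B`, `δ` only. -/
theorem exists_pi_kernel (k : ℕ) {B : ℝ} (hB : 0 ≤ B) {δ : ℝ → ℝ} (hδ : ∀ ε > 0, 0 < δ ε)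
    {ε : ℝ} (hε : 0 < ε) :
    ∃ (s : (Fin k → ℕ) → (Fin k → ℝ) → ℂ) (C : ℝ), IsBoundedKernel s C ∧
      ∀ σ : (Fin k → ℕ) → ℂ, (∀ n, ‖σ n‖ ≤ B) →
      (∀ ε > 0, ∀ m n, sqrtDist m n < δ ε → ‖σ m - σ n‖ < ε) →
      ∀ m, ‖∫ w, kernelSum s σ (fun i => ‖w i‖) ∂Measure.pi (fun i => radialMeasure (m i)) -
        σ m‖ ≤ ε := by
  induction k generalizing ε with
  | zero =>
    refine ⟨fun _ _ => 1, 1, ⟨fun _ => measurable_const, fun _ => Summable.of_finite,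
      fun _ => by simp⟩, fun σ _ _ m => ?_⟩
    have : ∀ x, kernelSum (fun (_ : Fin 0 → ℕ) (_ : Fin 0 → ℝ) => (1 : ℂ)) σ x = σ m := by
      intro x
      rw [kernelSum, tsum_fintype, Fintype.sum_unique, one_mul]
      congr 1
      exact Subsingleton.elim _ _
    simp only [this, integral_const, probReal_univ, one_smul, sub_self, norm_zero]
    exact hε.le
  | succ k ih =>
    obtain ⟨s, C, hs, hsσ⟩ := exists_kernel hB hδ (half_pos hε)
    have hC : 0 ≤ C := (norm_nonneg _).trans (hs.norm_le 0 0)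
    -- The kernel `s` in the first variable can magnify the error of `t` by the factor `C`.
    obtain ⟨t, D, ht, htσ⟩ := ih (ε := ε / (2 * (C + 1))) (by positivity)
    have hst := isBoundedKernel_consKernel hs ht
    refine ⟨consKernel s t, C * D, hst, fun σ hσ hσδ m => ?_⟩
    set m' : Fin k → ℕ := fun i => m i.succ with hm'
    have hm : m = Fin.cons (m 0) m' := (Fin.cons_self_tail m).symm
    have hsn : IsBoundedKernel (fun n (w : ℂ) => s n ‖w‖) C := hs.comp measurable_norm
    have hnm : ∀ j, Measurable fun (w : Fin j → ℂ) i => ‖w i‖ := fun j =>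
      measurable_pi_lambda _ fun i => (measurable_pi_apply i).norm
    have htn : IsBoundedKernel (fun n (w : Fin k → ℂ) => t n fun i => ‖w i‖) D := ht.comp (hnm k)
    have hstn : IsBoundedKernel (fun n (w : Fin (k + 1) → ℂ) => consKernel s t n fun i => ‖w i‖)
      (C * D) := hst.comp (hnm (k + 1))
    have hi : Integrable (fun w : Fin (k + 1) → ℂ => kernelSum (consKernel s t) σ fun i => ‖w i‖)
        (Measure.pi fun i => radialMeasure (m i)) := hstn.integrable_kernelSum hσ hB _
    -- `U a` is what `t` recovers from the slice of `σ` with first index `a`. All slices share the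
    -- bound `B` and the modulus `δ`, so `U` is uniformly close to the true values `τ`. Only `τ`
    -- needs to satisfy the continuity condition for `s`; for `U - τ` the norm bound `C` suffices.
    set U : ℕ → ℂ := fun a => ∫ w, kernelSum t (fun n => σ (Fin.cons a n)) (fun i => ‖w i‖)
      ∂Measure.pi (fun i => radialMeasure (m' i)) with hU
    set τ : ℕ → ℂ := fun a => σ (Fin.cons a m') with hτ
    have hUτ : ∀ a, ‖U a - τ a‖ ≤ ε / (2 * (C + 1)) := fun a =>
      htσ (fun n => σ (Fin.cons a n)) (fun n => hσ _) (fun ε hε p q hpq =>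
        hσδ ε hε _ _ (by rwa [sqrtDist_cons_right])) m'
    have hUb : ∀ a, ‖U a‖ ≤ D * B := fun a =>
      htn.norm_integral_kernelSum_le (fun n => hσ (Fin.cons a n)) hB
        (Measure.pi fun i => radialMeasure (m' i))
    have hDB : 0 ≤ D * B := (norm_nonneg _).trans (hUb 0)
    have hτ1 : ‖∫ w, kernelSum s τ ‖w‖ ∂radialMeasure (m 0) - σ m‖ ≤ ε / 2 := by
      have := hsσ τ (fun n => hσ _) (fun ε hε p q hpq =>
        hσδ ε hε _ _ (by rwa [sqrtDist_cons_left])) (m 0)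
      rwa [show τ (m 0) = σ m from congrArg σ hm.symm] at this
    have hcons : ∀ (w₀ : ℂ) (w : Fin k → ℂ), (fun i => ‖(Fin.cons w₀ w : Fin (k + 1) → ℂ) i‖) =
        Fin.cons ‖w₀‖ fun i => ‖w i‖ := by
      intro w₀ w; ext i
      refine Fin.cases ?_ (fun i => ?_) i <;> simp
    have hmain : ∫ w, kernelSum (consKernel s t) σ (fun i => ‖w i‖)
        ∂Measure.pi (fun i => radialMeasure (m i)) =
        ∫ w, kernelSum s U ‖w‖ ∂radialMeasure (m 0) := by
      rw [integral_pi_radialMeasure_succ m hi]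
      congr 1; ext w₀
      simp_rw [hcons, kernelSum_consKernel hs ht hσ]
      exact integral_tsum_mul (B := D * B) (hs.summable ‖w₀‖)
        (fun a => measurable_kernelSum htn.measurable)
        fun a w => htn.norm_kernelSum_le (fun n => hσ (Fin.cons a n)) hB w
    have hdiff : ‖∫ w, kernelSum s U ‖w‖ ∂radialMeasure (m 0) -
        ∫ w, kernelSum s τ ‖w‖ ∂radialMeasure (m 0)‖ ≤ ε / 2 := by
      have i1 : Integrable (fun w : ℂ => kernelSum s U ‖w‖) (radialMeasure (m 0)) :=
        hsn.integrable_kernelSum hUb hDB _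
      have i2 : Integrable (fun w : ℂ => kernelSum s τ ‖w‖) (radialMeasure (m 0)) :=
        hsn.integrable_kernelSum (fun n => hσ (Fin.cons n m')) hB _
      rw [← integral_sub i1 i2]
      have e : ∀ w : ℂ, kernelSum s U ‖w‖ - kernelSum s τ ‖w‖ =
          kernelSum s (fun a => U a - τ a) ‖w‖ := by
        intro w
        simp_rw [kernelSum, mul_sub]
        rw [(summable_mul_of_bounded (hs.summable _) hUb).of_norm.tsum_sub
          (summable_mul_of_bounded (hs.summable _) fun n => hσ (Fin.cons n m')).of_norm]
      simp_rw [e]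
      calc _ ≤ C * (ε / (2 * (C + 1))) :=
            hsn.norm_integral_kernelSum_le hUτ (by positivity) (radialMeasure (m 0))
        _ ≤ ε / 2 := by
            rw [mul_div_assoc', div_le_div_iff₀ (by positivity) (by positivity)]
            nlinarith
    rw [hmain]
    have := norm_sub_le_norm_sub_add_norm_sub (∫ w, kernelSum s U ‖w‖ ∂radialMeasure (m 0))
      (∫ w, kernelSum s τ ‖w‖ ∂radialMeasure (m 0)) (σ m)
    linarith

/-! ### Density -/

theorem exists_mem_eigenvalueFunctions_norm_sub_le {k : ℕ} {σ : (Fin k → ℕ) →ᵇ ℂ}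
    (hσ : σ ∈ Cbu k) {ε : ℝ} (hε : 0 < ε) :
    ∃ γ ∈ eigenvalueFunctions k, ∀ m, ‖σ m - γ m‖ ≤ ε := by
  choose! δ hδ0 hδ using hσ
  obtain ⟨s, C, hs, hsσ⟩ := exists_pi_kernel k (norm_nonneg σ) hδ0 hε
  set φ : (Fin k → ℂ) → ℂ := fun w => kernelSum s σ fun i => ‖w i‖ with hφ
  have hnm : Measurable fun (w : Fin k → ℂ) i => ‖w i‖ :=
    measurable_pi_lambda _ fun i => (measurable_pi_apply i).norm
  have hφm : Measurable φ := (measurable_kernelSum hs.measurable).comp hnm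
  have hφr : IsSeparatelyRadialSymbol φ := by
    refine ⟨hφm, memLp_top_of_bound hφm.aestronglyMeasurable (C * ‖σ‖)
      (.of_forall fun w => hs.norm_kernelSum_le σ.norm_coe_le_norm (norm_nonneg σ) _), ?_⟩
    intro t z
    have h : (fun i => ‖(t i : ℂ) * z i‖) = fun i => ‖z i‖ := by
      ext i
      rw [norm_mul, Circle.norm_coe, one_mul]
    exact congrArg (kernelSum s σ) h
  refine ⟨fun m => ∫ w, φ w ∂Measure.pi fun i => radialMeasure (m i),
    ⟨φ, hφr, (isEigenvalueFunction_iff hφr _).2 fun m => rfl⟩, fun m => ?_⟩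
  rw [norm_sub_rev]
  exact hsσ σ σ.norm_coe_le_norm hδ m

end FockToeplitz

end

/-- The eigenvalue functions of Toeplitz operators on the Fock space `F(ℂᵏ)` with separately radial
symbols belong to `C_{b,u}(ℕ₀ᵏ, ρ)`, and they are dense there in the supremum norm. -/
theorem theorem5p9 (k : ℕ) (hk : 0 < k) :
    (∀ γ ∈ FockToeplitz.eigenvalueFunctions k, ∃ σ ∈ FockToeplitz.Cbu k, ⇑σ = γ) ∧
    Dense {σ : FockToeplitz.Cbu k |
      ⇑(σ : BoundedContinuousFunction (Fin k → ℕ) ℂ) ∈ FockToeplitz.eigenvalueFunctions k} := by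
  refine ⟨fun γ hγ => FockToeplitz.exists_mem_Cbu_of_mem_eigenvalueFunctions hγ, ?_⟩
  refine Metric.dense_iff.2 fun σ ε hε => ?_
  -- Halving `ε` makes the supremum distance strictly smaller than `ε`, since the pointwise bounds
  -- only give `≤`.
  obtain ⟨γ, hγ, hle⟩ :=
    FockToeplitz.exists_mem_eigenvalueFunctions_norm_sub_le σ.2 (half_pos hε)
  obtain ⟨τ, hτ, rfl⟩ := FockToeplitz.exists_mem_Cbu_of_mem_eigenvalueFunctions hγ
  refine ⟨⟨τ, hτ⟩, ?_, hγ⟩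
  rw [Metric.mem_ball, dist_comm]
  refine lt_of_le_of_lt ?_ (half_lt_self hε)
  refine (BoundedContinuousFunction.dist_le (half_pos hε).le).2 fun m => ?_
  rw [dist_eq_norm]
  exact hle m
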